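/- Let $M\ge 2$. A transmitter with $M$ antennas and total power $P$ serves $M$ single-antenna users. The channel vectors $\mathbf h_1,\dots,\mathbf h_M\in\mathbb C^M$ have i.i.d. circularly symmetric complex Gaussian entries of mean zero and unit variance. User $i$ has its own random codebook of $2^{B}$ vectors $\mathbf w_{i,1},\dots,\mathbf w_{i,2^B}$; all codebook vectors are i.i.d. with the isotropic (unitarily invariant) distribution on the unit sphere of $\mathbb C^M$ and independent of the channels. User $i$ feeds back the $B$-bit index of a codebook vector $\hat{\mathbf h}_i=\mathbf w_{i,F_i}$ with $F_i=\arg\max_j|\mathbf h_i^\dagger\mathbf w_{i,j}|$. The transmitter uses the zero-forcing beamforming vectors $\mathbf v_1,\dots,\mathbf v_M$, which are the normalized columns of the inverse of the matrix with rows $\hat{\mathbf h}_1^\dagger,\dots,\hat{\mathbf h}_M^\dagger$ (almost surely invertible), with power $P/M$ for each user. With unit noise variance, let $$\mathrm{SINR}_i=\frac{\frac PM|\mathbf h_i^\dagger\mathbf v_i|^2}{1+\sum_{j\ne i}\frac PM|\mathbf h_i^\dagger\mathbf v_j|^2},\qquad R_{FB}(P)=\sum_{i=1}^M E\big[\log_2(1+\mathrm{SINR}_i)\big],$$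 the expectation being over the channels and the codebooks. Suppose that the number of feedback bits per user scales as $\alpha\log_2P$ with $\alpha<M-1$, that is, $B=B(P)$ is a nonnegative integer for every $P$ and $B(P)/\log_2P\to\alpha$ as $P\to\infty$ (for example $B(P)=\lfloor\alpha\log_2P\rfloor$ with $\alpha\ge0$ and $P\ge1$; the assumption forces $\alpha\ge 0$). Then the expectations above are finite for every $P>0$, and feedback-based zero-forcing achieves the multiplexing gain $$\lim_{P\to\infty}\frac{R_{FB}(P)}{\log_2P}=M\,\frac{\alpha}{M-1},$$ which is strictly smaller than $M$. -/

import Mathlib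

open MeasureTheory ProbabilityTheory Filter Topology

noncomputable section

namespace LimitedFeedback

/-- The space `ℂ^M` with the Euclidean norm and `inner ℂ x y = x† y`. -/
abbrev CVec (M : ℕ) : Type := EuclideanSpace ℂ (Fin M)

/-- The law of a circularly symmetric complex Gaussian of mean zero and unit variance:
real and imaginary parts are independent real Gaussians of variance `1/2`. -/
def complexGaussian : Measure ℂ :=
  ((gaussianReal 0 (1 / 2)).prod (gaussianReal 0 (1 / 2))).map
    (fun p : ℝ × ℝ => (⟨p.1, p.2⟩ : ℂ))

/-- The law of the channel vector of one user: iid unit variance complex Gaussian entries. -/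
def channelLaw (M : ℕ) : Measure (CVec M) :=
  (Measure.pi (fun _ : Fin M => complexGaussian)).map (WithLp.toLp 2)

/-- `μ` is the isotropic distribution on the unit sphere of `ℂ^M`: a probability measure carried
by the unit sphere and invariant under all unitary transformations. -/
structure IsIsotropic {M : ℕ} (μ : Measure (CVec M)) : Prop where
  isProbabilityMeasure : IsProbabilityMeasure μ
  norm_eq_one : ∀ᵐ x ∂μ, ‖x‖ = 1
  map_unitary : ∀ U : CVec M ≃ₗᵢ[ℂ] CVec M, μ.map U = μ

/-- A codebook of `2 ^ B` quantization vectors in `ℂ^M`. -/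
abbrev Codebook (M B : ℕ) : Type := Fin (2 ^ B) → CVec M

open Classical in
/-- The set of indices `j` that maximize `|h† w_j|`. -/
def maximizers {M B : ℕ} (h : CVec M) (w : Codebook M B) : Finset (Fin (2 ^ B)) :=
  Finset.univ.filter (fun j => ∀ k, ‖inner ℂ h (w k)‖ ≤ ‖inner ℂ h (w j)‖)

theorem maximizers_nonempty {M B : ℕ} (h : CVec M) (w : Codebook M B) :
    (maximizers h w).Nonempty := by
  classical
  obtain ⟨j, -, hj⟩ := Finset.exists_max_image (Finset.univ : Finset (Fin (2 ^ B)))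
    (fun j => ‖inner ℂ h (w j)‖) Finset.univ_nonempty
  exact ⟨j, by simpa [maximizers] using hj⟩

/-- The feedback index `argmax_j |h† w_j|`. Ties, which have probability zero for random codebooks,
are broken in favour of the smallest index. -/
def feedbackIndex {M B : ℕ} (h : CVec M) (w : Codebook M B) : Fin (2 ^ B) :=
  (maximizers h w).min' (maximizers_nonempty h w)

/-- The quantization `ĥ` of the channel vector `h` by the codebook `w`. -/
def quantize {M B : ℕ} (h : CVec M) (w : Codebook M B) : CVec M :=
  w (feedbackIndex h w)

/-- The matrix whose `i`-th row is `(g i)†`. -/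
def channelMatrix {M : ℕ} (g : Fin M → CVec M) : Matrix (Fin M) (Fin M) ℂ :=
  Matrix.of (fun i k => star (g i k))

/-- Column `i` of the inverse of the matrix with rows `(g i)†`. -/
def inverseColumn {M : ℕ} (g : Fin M → CVec M) (i : Fin M) : CVec M :=
  WithLp.toLp 2 (fun k => (channelMatrix g)⁻¹ k i)

/-- The zero-forcing beamforming vectors for `g`: the normalized columns of the inverse of the
matrix with rows `(g i)†`. -/
def zeroForcing {M : ℕ} (g : Fin M → CVec M) (i : Fin M) : CVec M :=
  ((‖inverseColumn g i‖⁻¹ : ℝ) : ℂ) • inverseColumn g i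

/-- The SINR of user `i` with channels `h`, beamforming vectors `v`, total power `P` split equally
among the `M` streams and unit noise variance. -/
def sinr {M : ℕ} (P : ℝ) (h v : Fin M → CVec M) (i : Fin M) : ℝ :=
  (P / M * ‖inner ℂ (h i) (v i)‖ ^ 2) /
    (1 + ∑ j ∈ Finset.univ.erase i, P / M * ‖inner ℂ (h i) (v j)‖ ^ 2)

/-- The SINR of user `i` when zero-forcing is performed on the quantized channels, user `j`
quantizing its own channel `h j` with its own codebook `w j`. -/
def feedbackSinr {M B : ℕ} (P : ℝ) (h : Fin M → CVec M) (w : Fin M → Codebook M B)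
    (i : Fin M) : ℝ :=
  sinr P h (zeroForcing (fun j => quantize (h j) (w j))) i

/-- The joint law of the `M` channel vectors and the `M` codebooks of `2 ^ B` vectors: all channel
vectors and all quantization vectors are independent, the quantization vectors have law `μ`. -/
def systemLaw {M : ℕ} (μ : Measure (CVec M)) (B : ℕ) :
    Measure ((Fin M → CVec M) × (Fin M → Codebook M B)) :=
  (Measure.pi (fun _ : Fin M => channelLaw M)).prod
    (Measure.pi (fun _ : Fin M => Measure.pi (fun _ : Fin (2 ^ B) => μ)))

/-- The instantaneous rate `log₂ (1 + SINR_i)` of user `i`. -/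
def instantRate {M B : ℕ} (P : ℝ) (i : Fin M)
    (x : (Fin M → CVec M) × (Fin M → Codebook M B)) : ℝ :=
  Real.logb 2 (1 + feedbackSinr P x.1 x.2 i)

/-- The long-term average rate `R_i = E[log₂ (1 + SINR_i)]` of user `i`, over fading and random
codebooks. -/
def userRate {M : ℕ} (μ : Measure (CVec M)) (B : ℕ) (P : ℝ) (i : Fin M) : ℝ :=
  ∫ x, instantRate P i x ∂(systemLaw μ B)

/-- The system throughput `R_FB(P)` of feedback-based zero-forcing with `B` bits per user: the sum
of the rates of the `M` users. -/
def throughput {M : ℕ} (μ : Measure (CVec M)) (B : ℕ) (P : ℝ) : ℝ :=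
  ∑ i : Fin M, userRate μ B P i

/-- The throughput curve `R` has multiplexing gain `r`: `R(P) / log₂ P → r` as `P → ∞`. -/
def HasMultiplexingGain (R : ℝ → ℝ) (r : ℝ) : Prop :=
  Tendsto (fun P => R P / Real.logb 2 P) atTop (𝓝 r)

end LimitedFeedback

end

/-! The rate of a user is governed by its quantization error, the squared sine `sinSq` of the angle
between the channel and the chosen codeword. A cap of squared radius t has isotropic mass of order
t^(M-1) (`IsIsotropic.exists_cap_bounds`), so the best of 2^B words has error about 2^(-B/(M-1)),
that is about P^(-α/(M-1)). The received signal power is of order P‖h‖², the interference of order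
P‖h‖² times the error, and α < M-1 keeps the interference above the noise. Hence the SINR grows like
P^(α/(M-1)), up to factors P^η with η arbitrarily small.

The geometry of zero-forcing enters through `inverseEnergy` alone: `sinr_zeroForcing_le` and
`le_sinr_zeroForcing` bound the SINR deterministically by the inverse error, at the cost of powers
of a bound on `inverseEnergy` (and, for the lower bound, on ‖h‖⁻²). By unitary invariance and
uniqueness of the isotropic law, the quantized channels are themselves iid isotropic for every B
(`IsIsotropic.measurePreserving_quantize`). The law of `inverseEnergy` is therefore independent of
P, and it exceeds P^η with vanishing probability. Union bounds then suffice; neither moments of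
`inverseEnergy` nor its independence from the quantization error are needed.

Convergence in probability becomes convergence of expectations through `userRate_le` and
`le_userRate`: on exceptional events the rate costs at most log P plus an integrable term. -/

namespace LimitedFeedback

/-! ### Unitary invariance and uniqueness of the isotropic law. -/

section Isotropy

variable {M : ℕ}

/-- The isometry c • u ↦ c • v between complex lines extends to the whole space, and is onto by
equality of dimensions. -/
theorem exists_unitary_map_eq {u v : CVec M} (h : ‖u‖ = ‖v‖) :
    ∃ U : CVec M ≃ₗᵢ[ℂ] CVec M, U u = v := by
  rcases eq_or_ne u 0 with rfl | hu
  · exact ⟨LinearIsometryEquiv.refl ℂ _, (norm_eq_zero.1 (h.symm.trans norm_zero)).symm⟩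
  let e := LinearEquiv.toSpanNonzeroSingleton ℂ (CVec M) u hu
  let L : (ℂ ∙ u) →ₗᵢ[ℂ] CVec M :=
    { toLinearMap := (LinearMap.toSpanSingleton ℂ (CVec M) v).comp e.symm.toLinearMap
      norm_map' := fun x => by
        obtain ⟨c, rfl⟩ := e.surjective x
        simp only [LinearMap.comp_apply, LinearEquiv.coe_coe, LinearEquiv.symm_apply_apply,
          LinearMap.toSpanSingleton_apply, norm_smul, ← h]
        simp [e, norm_smul] }
  refine ⟨L.extend.toLinearIsometryEquiv rfl, ?_⟩
  have h1 := L.extend_apply ⟨u, Submodule.mem_span_singleton_self u⟩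
  have h2 : (⟨u, Submodule.mem_span_singleton_self u⟩ : ℂ ∙ u) = e 1 := by
    ext1; simp [e]
  simp only [LinearIsometry.coe_toLinearIsometryEquiv]
  rw [h1, h2]
  simp [L]

theorem real_inner_eq_re (x y : CVec M) : inner ℝ x y = (inner ℂ x y).re := by
  simp [PiLp.inner_apply]

theorem real_inner_unitary (U : CVec M ≃ₗᵢ[ℂ] CVec M) (x y : CVec M) :
    inner ℝ (U x) (U y) = inner ℝ x y := by
  rw [real_inner_eq_re, real_inner_eq_re, LinearIsometryEquiv.inner_map_map]

theorem charFun_unitary {μ : Measure (CVec M)} (hμ : ∀ U : CVec M ≃ₗᵢ[ℂ] CVec M, μ.map U = μ)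
    (U : CVec M ≃ₗᵢ[ℂ] CVec M) (t : CVec M) : charFun μ (U t) = charFun μ t := by
  have hU : Measurable U := U.continuous.measurable
  conv_lhs => rw [← hμ U]
  rw [charFun_apply, charFun_apply, integral_map hU.aemeasurable (by fun_prop)]
  simp only [real_inner_unitary]

theorem charFun_eq_of_norm_eq {μ : Measure (CVec M)}
    (hμ : ∀ U : CVec M ≃ₗᵢ[ℂ] CVec M, μ.map U = μ) {s t : CVec M} (h : ‖s‖ = ‖t‖) :
    charFun μ s = charFun μ t := by
  obtain ⟨U, rfl⟩ := exists_unitary_map_eq h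
  rw [charFun_unitary hμ]

/-- An isotropic distribution on the unit sphere is unique. -/
theorem IsIsotropic.eq {μ ν : Measure (CVec M)} (hμ : IsIsotropic μ) (hν : IsIsotropic ν) :
    μ = ν := by
  have := hμ.isProbabilityMeasure
  have := hν.isProbabilityMeasure
  refine Measure.ext_of_charFun ?_
  ext t
  -- Both characteristic functions are radial, so averaging one of them over the sphere of radius
  -- ‖t‖ against the other measure returns its value at t. By Fubini and symmetry of the inner
  -- product the two averages coincide.
  have e1 : ∀ᵐ x ∂ν, charFun μ (‖t‖ • x) = charFun μ t := by
    filter_upwards [hν.norm_eq_one] with x hx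
    exact charFun_eq_of_norm_eq hμ.map_unitary (by simp [norm_smul, hx])
  have e2 : ∀ᵐ x ∂μ, charFun ν (‖t‖ • x) = charFun ν t := by
    filter_upwards [hμ.norm_eq_one] with x hx
    exact charFun_eq_of_norm_eq hν.map_unitary (by simp [norm_smul, hx])
  have i1 : ∫ x, charFun μ (‖t‖ • x) ∂ν = charFun μ t := by
    rw [integral_congr_ae e1]; simp
  have i2 : ∫ x, charFun ν (‖t‖ • x) ∂μ = charFun ν t := by
    rw [integral_congr_ae e2]; simp
  rw [← i1, ← i2]
  simp only [charFun_apply]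
  rw [integral_integral_swap]
  · refine integral_congr_ae (ae_of_all _ fun x => integral_congr_ae (ae_of_all _ fun y => ?_))
    simp only [real_inner_smul_right, real_inner_comm x y]
  · refine Integrable.of_bound (by fun_prop) 1 (ae_of_all _ fun p => ?_)
    simp only [Function.uncurry]
    rw [Complex.norm_exp_ofReal_mul_I]

end Isotropy

/-! ### Characteristic function and unitary invariance of the channel law. -/

section Gaussian

variable {M : ℕ}

instance : IsProbabilityMeasure complexGaussian :=
  Measure.isProbabilityMeasure_map (by
    exact (Complex.measurableEquivRealProd.symm.measurable).aemeasurable)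

instance : IsProbabilityMeasure (channelLaw M) :=
  Measure.isProbabilityMeasure_map (by fun_prop)

theorem measurable_complex_mk : Measurable (fun p : ℝ × ℝ => (⟨p.1, p.2⟩ : ℂ)) :=
  Complex.measurableEquivRealProd.symm.measurable

theorem charFun_complexGaussian (z : ℂ) :
    charFun complexGaussian z = Complex.exp (-(‖z‖ ^ 2 / 4 : ℝ)) := by
  rw [complexGaussian, charFun_apply, integral_map measurable_complex_mk.aemeasurable
    (by fun_prop)]
  have : ∀ p : ℝ × ℝ, Complex.exp ((inner ℝ (⟨p.1, p.2⟩ : ℂ) z : ℝ) * Complex.I) =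
      Complex.exp ((inner ℝ p.1 z.re : ℝ) * Complex.I) *
      Complex.exp ((inner ℝ p.2 z.im : ℝ) * Complex.I) := by
    intro p
    rw [← Complex.exp_add]
    congr 1
    simp [Complex.inner]
    ring
  simp only [this]
  rw [integral_prod_mul (fun x : ℝ => Complex.exp ((inner ℝ x z.re : ℝ) * Complex.I))
    (fun x : ℝ => Complex.exp ((inner ℝ x z.im : ℝ) * Complex.I)), ← charFun_apply,
    ← charFun_apply, charFun_gaussianReal, charFun_gaussianReal, ← Complex.exp_add,
    ← Complex.normSq_eq_norm_sq, Complex.normSq_apply]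
  congr 1
  push_cast
  ring

theorem charFun_channelLaw (t : CVec M) :
    charFun (channelLaw M) t = Complex.exp (-(‖t‖ ^ 2 / 4 : ℝ)) := by
  rw [channelLaw, charFun_pi]
  simp only [charFun_complexGaussian]
  rw [← Complex.exp_sum, EuclideanSpace.norm_sq_eq]
  congr 1
  push_cast
  rw [Finset.sum_neg_distrib, Finset.sum_div]

/-- The characteristic function depends on ‖t‖ only. -/
theorem channelLaw_map_unitary (U : CVec M ≃ₗᵢ[ℂ] CVec M) :
    (channelLaw M).map U = channelLaw M := by
  have hU : Measurable U := U.continuous.measurable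
  have : IsProbabilityMeasure ((channelLaw M).map U) :=
    Measure.isProbabilityMeasure_map hU.aemeasurable
  refine Measure.ext_of_charFun ?_
  ext t
  rw [charFun_apply, integral_map hU.aemeasurable (by fun_prop)]
  have : ∀ x, inner ℝ (U x) t = inner ℝ x (U.symm t) := fun x => by
    rw [← real_inner_unitary U x, U.apply_symm_apply]
  simp only [this]
  rw [← charFun_apply, charFun_channelLaw, charFun_channelLaw, U.symm.norm_map]

end Gaussian

/-! ### Small-ball estimates for one Gaussian entry. -/

section SmallBall

/-- The density is at most 1/√π < 1. -/
theorem gaussianReal_half_le_volume (s : Set ℝ) : gaussianReal 0 (1 / 2) s ≤ volume s := by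
  rw [gaussianReal_apply 0 (by norm_num) s]
  calc ∫⁻ x in s, gaussianPDF 0 (1 / 2) x ≤ ∫⁻ _ in s, 1 := by
        refine lintegral_mono fun x => ?_
        rw [gaussianPDF, ENNReal.ofReal_le_one, gaussianPDFReal]
        have h1 : (1 : ℝ) ≤ √(2 * Real.pi * ((1 / 2 : NNReal) : ℝ)) := by
          rw [Real.one_le_sqrt]
          push_cast
          linarith [Real.pi_gt_three]
        have h2 : Real.exp (-(x - 0) ^ 2 / (2 * ((1 / 2 : NNReal) : ℝ))) ≤ 1 := by
          rw [Real.exp_le_one_iff]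
          push_cast
          nlinarith [sq_nonneg x]
        exact mul_le_one₀ (inv_le_one_of_one_le₀ h1) (Real.exp_pos _).le h2
    _ = volume s := by simp

theorem exists_le_gaussianReal_half :
    ∃ c : ℝ, 0 < c ∧ ∀ a : ℝ, 0 ≤ a → a ≤ 1 →
      ENNReal.ofReal (c * a) ≤ gaussianReal 0 (1 / 2) (Set.Icc (-a) a) := by
  have hc : 0 < gaussianPDFReal 0 (1 / 2) 1 := gaussianPDFReal_pos _ _ _ (by norm_num)
  -- On [-1, 1] the density is smallest at the endpoints; the factor 2 comes from the length 2a.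
  refine ⟨gaussianPDFReal 0 (1 / 2) 1 * 2, by positivity, fun a ha0 ha1 => ?_⟩
  rw [gaussianReal_apply 0 (by norm_num)]
  calc ENNReal.ofReal (gaussianPDFReal 0 (1 / 2) 1 * 2 * a)
      = ∫⁻ _ in Set.Icc (-a) a, gaussianPDF 0 (1 / 2) 1 := by
        rw [setLIntegral_const, Real.volume_Icc, gaussianPDF, ← ENNReal.ofReal_mul hc.le]
        congr 1
        ring
    _ ≤ _ := by
        refine setLIntegral_mono' measurableSet_Icc fun x hx => ?_
        refine ENNReal.ofReal_le_ofReal ?_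
        simp only [gaussianPDFReal]
        refine mul_le_mul_of_nonneg_left (Real.exp_le_exp.2 ?_) (by positivity)
        have : x ^ 2 ≤ 1 := by nlinarith [hx.1, hx.2]
        push_cast
        linarith

theorem complexGaussian_le {t : ℝ} (ht : 0 ≤ t) :
    complexGaussian {z | ‖z‖ ^ 2 ≤ t} ≤ ENNReal.ofReal (4 * t) := by
  rw [complexGaussian, Measure.map_apply measurable_complex_mk
    (measurableSet_le (by fun_prop) (by fun_prop))]
  calc _ ≤ ((gaussianReal 0 (1 / 2)).prod (gaussianReal 0 (1 / 2)))
        (Set.Icc (-√t) (√t) ×ˢ Set.Icc (-√t) (√t)) := by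
        refine measure_mono fun p hp => ?_
        have hp' : p.1 * p.1 + p.2 * p.2 ≤ t := by
          have : ‖(⟨p.1, p.2⟩ : ℂ)‖ ^ 2 ≤ t := hp
          rwa [← Complex.normSq_eq_norm_sq, Complex.normSq_apply] at this
        refine ⟨abs_le.1 (Real.abs_le_sqrt ?_), abs_le.1 (Real.abs_le_sqrt ?_)⟩ <;>
          nlinarith [mul_self_nonneg p.1, mul_self_nonneg p.2]
    _ ≤ ENNReal.ofReal (2 * √t) * ENNReal.ofReal (2 * √t) := by
        rw [Measure.prod_prod]
        have : gaussianReal 0 (1 / 2) (Set.Icc (-√t) (√t)) ≤ ENNReal.ofReal (2 * √t) := by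
          refine (gaussianReal_half_le_volume _).trans ?_
          rw [Real.volume_Icc]
          exact ENNReal.ofReal_le_ofReal (by linarith)
        gcongr
    _ = _ := by
        rw [← ENNReal.ofReal_mul (by positivity)]
        congr 1
        nlinarith [Real.mul_self_sqrt ht]

theorem exists_le_complexGaussian :
    ∃ c : ℝ, 0 < c ∧ ∀ t : ℝ, 0 ≤ t → t ≤ 1 →
      ENNReal.ofReal (c * t) ≤ complexGaussian {z | ‖z‖ ^ 2 ≤ t} := by
  obtain ⟨c, hc, h⟩ := exists_le_gaussianReal_half
  refine ⟨c ^ 2 / 2, by positivity, fun t ht0 ht1 => ?_⟩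
  rw [complexGaussian, Measure.map_apply measurable_complex_mk
    (measurableSet_le (by fun_prop) (by fun_prop))]
  -- Half-side of the square inscribed in the disc of squared radius t.
  set a := √(t / 2) with ha
  have ha2 : a * a = t / 2 := Real.mul_self_sqrt (by linarith)
  have ha0 : 0 ≤ a := Real.sqrt_nonneg _
  have ha1 : a ≤ 1 := by nlinarith
  calc ENNReal.ofReal (c ^ 2 / 2 * t) = ENNReal.ofReal (c * a) * ENNReal.ofReal (c * a) := by
        rw [← ENNReal.ofReal_mul (by positivity)]
        congr 1
        linear_combination (-c ^ 2) * ha2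
    _ ≤ ((gaussianReal 0 (1 / 2)).prod (gaussianReal 0 (1 / 2)))
        (Set.Icc (-a) a ×ˢ Set.Icc (-a) a) := by
        rw [Measure.prod_prod]
        have := h a ha0 ha1
        gcongr
    _ ≤ _ := by
        refine measure_mono fun p hp => ?_
        change ‖(⟨p.1, p.2⟩ : ℂ)‖ ^ 2 ≤ t
        rw [← Complex.normSq_eq_norm_sq, Complex.normSq_apply]
        obtain ⟨⟨h1, h2⟩, h3, h4⟩ := hp
        dsimp only at *
        nlinarith

/-- The annulus keeps the distinguished coordinate away from 0 while leaving room for the others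
inside the unit ball. -/
theorem complexGaussian_annulus_pos :
    0 < complexGaussian ({z | 1 / 4 ≤ ‖z‖ ^ 2} ∩ {z | ‖z‖ ^ 2 ≤ 1 / 2}) := by
  rw [complexGaussian, Measure.map_apply measurable_complex_mk
    ((measurableSet_le (by fun_prop) (by fun_prop)).inter
      (measurableSet_le (by fun_prop) (by fun_prop)))]
  have hpos : ∀ a b : ℝ, a < b → 0 < gaussianReal 0 (1 / 2) (Set.Icc a b) := fun a b hab => by
    refine pos_iff_ne_zero.2 fun h0 => ?_
    have := gaussianReal_absolutelyContinuous' 0 (by norm_num : (1 / 2 : NNReal) ≠ 0) h0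
    rw [Real.volume_Icc, ENNReal.ofReal_eq_zero] at this
    linarith
  calc 0 < ((gaussianReal 0 (1 / 2)).prod (gaussianReal 0 (1 / 2)))
        (Set.Icc (1 / 2) (3 / 5) ×ˢ Set.Icc 0 (1 / 10)) := by
        rw [Measure.prod_prod]
        exact ENNReal.mul_pos (hpos _ _ (by norm_num)).ne' (hpos _ _ (by norm_num)).ne'
    _ ≤ _ := by
        refine measure_mono fun p hp => ?_
        change 1 / 4 ≤ ‖(⟨p.1, p.2⟩ : ℂ)‖ ^ 2 ∧ ‖(⟨p.1, p.2⟩ : ℂ)‖ ^ 2 ≤ 1 / 2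
        rw [← Complex.normSq_eq_norm_sq, Complex.normSq_apply]
        obtain ⟨⟨h1, h2⟩, h3, h4⟩ := hp
        dsimp only at *
        constructor <;> nlinarith

end SmallBall

/-! ### Gaussian mass of a thin cone around a coordinate axis, inside the unit ball. -/

section Rectangles

variable {M : ℕ}

theorem channelLaw_rectangle (s : Fin M → Set ℂ) (hs : ∀ i, MeasurableSet (s i)) :
    channelLaw M {x | ∀ i, x i ∈ s i} = ∏ i, complexGaussian (s i) := by
  have hm : MeasurableSet {x : CVec M | ∀ i, x i ∈ s i} := by
    have : {x : CVec M | ∀ i, x i ∈ s i} = ⋂ i, (fun x : CVec M => x i) ⁻¹' s i := by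
      ext; simp
    rw [this]
    exact MeasurableSet.iInter fun i => (by fun_prop : Measurable fun x : CVec M => x i) (hs i)
  rw [channelLaw, Measure.map_apply (by fun_prop) hm, ← Measure.pi_pi]
  congr 1
  ext x
  simp

theorem channelLaw_coord_eq_zero (i : Fin M) : channelLaw M {x | x i = 0} = 0 := by
  classical
  have h := channelLaw_rectangle (fun j : Fin M => if j = i then {0} else Set.univ)
    (fun j => by split_ifs <;> measurability)
  have h0 : complexGaussian {0} = 0 := by
    have := complexGaussian_le (le_refl (0 : ℝ))
    simpa using this
  rw [Finset.prod_eq_zero (Finset.mem_univ i) (by simp [h0])] at h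
  rw [← h]
  congr 1
  ext x
  simp only [Set.mem_ofPred_eq]
  constructor
  · intro hx j
    split_ifs with hj
    · simpa [hj] using hx
    · trivial
  · intro hx
    simpa using hx i

theorem ae_channelLaw_ne_zero (hM : 0 < M) : ∀ᵐ x ∂(channelLaw M), x ≠ 0 := by
  refine measure_mono_null (fun x hx => ?_) (channelLaw_coord_eq_zero ⟨0, hM⟩)
  have : x = 0 := by simpa using hx
  simp [this]

theorem norm_sq_eq_add (i : Fin M) (x : CVec M) :
    ‖x‖ ^ 2 = ‖x i‖ ^ 2 + ∑ k ∈ Finset.univ.erase i, ‖x k‖ ^ 2 := by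
  rw [EuclideanSpace.norm_sq_eq,
    Finset.add_sum_erase _ (fun k => ‖x k‖ ^ 2) (Finset.mem_univ i)]

/-- Inside the unit ball the cone condition forces |x j|² ≤ t for the M-1 coordinates j ≠ i, which
is a product event. The truncation to the ball is there to make this possible. -/
theorem channelLaw_cylinder_le (i : Fin M) {t : ℝ} (ht : 0 ≤ t) :
    channelLaw M {x | ‖x‖ ≤ 1 ∧ ‖x‖ ^ 2 - ‖x i‖ ^ 2 ≤ t * ‖x‖ ^ 2} ≤
      ENNReal.ofReal ((4 * t) ^ (M - 1)) := by
  classical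
  calc _ ≤ channelLaw M
        {x | ∀ j, x j ∈ (if j = i then Set.univ else {z : ℂ | ‖z‖ ^ 2 ≤ t})} := by
        refine measure_mono fun x ⟨h1, h2⟩ j => ?_
        split_ifs with hj
        · trivial
        · have h3 : ‖x j‖ ^ 2 ≤ ∑ k ∈ Finset.univ.erase i, ‖x k‖ ^ 2 :=
            Finset.single_le_sum (f := fun k => ‖x k‖ ^ 2) (fun _ _ => by positivity)
              (Finset.mem_erase.2 ⟨hj, Finset.mem_univ j⟩)
          have h4 := norm_sq_eq_add i x
          have h5 : ‖x‖ ^ 2 ≤ 1 := by nlinarith [norm_nonneg x]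
          change ‖x j‖ ^ 2 ≤ t
          nlinarith
    _ = ∏ j, complexGaussian (if j = i then Set.univ else {z : ℂ | ‖z‖ ^ 2 ≤ t}) :=
        channelLaw_rectangle _ fun j => by
          split_ifs
          · exact MeasurableSet.univ
          · exact measurableSet_le (by fun_prop) (by fun_prop)
    _ = ∏ j ∈ Finset.univ.erase i, complexGaussian {z : ℂ | ‖z‖ ^ 2 ≤ t} := by
        rw [← Finset.mul_prod_erase _ _ (Finset.mem_univ i)]
        simp only [if_true, measure_univ, one_mul]
        exact Finset.prod_congr rfl fun j hj => by rw [if_neg (Finset.ne_of_mem_erase hj)]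
    _ ≤ ENNReal.ofReal ((4 * t) ^ (M - 1)) := by
        rw [Finset.prod_const, Finset.card_erase_of_mem (Finset.mem_univ i), Finset.card_univ,
          Fintype.card_fin, ENNReal.ofReal_pow (by positivity)]
        gcongr
        exact complexGaussian_le ht

/-- A product set fits inside the truncated cone: with |x i|² in [1/4, 1/2] and the other |x j|² at
most t/(4M), the others sum to at most t/4 ≤ t|x i|², and ‖x‖ ≤ 1. -/
theorem exists_le_channelLaw_cylinder (i : Fin M) :
    ∃ c : ℝ, 0 < c ∧ ∀ t : ℝ, 0 ≤ t → t ≤ 1 → ENNReal.ofReal (c * t ^ (M - 1)) ≤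
      channelLaw M {x | ‖x‖ ≤ 1 ∧ ‖x‖ ^ 2 - ‖x i‖ ^ 2 ≤ t * ‖x‖ ^ 2} := by
  classical
  obtain ⟨c, hc, h⟩ := exists_le_complexGaussian
  have hM : (1 : ℝ) ≤ M := by exact_mod_cast (Fin.pos i : 0 < M)
  set A : Set ℂ := {z | 1 / 4 ≤ ‖z‖ ^ 2} ∩ {z | ‖z‖ ^ 2 ≤ 1 / 2} with hA
  have hAm : MeasurableSet A := (measurableSet_le (by fun_prop) (by fun_prop)).inter
      (measurableSet_le (by fun_prop) (by fun_prop))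
  have hp : 0 < (complexGaussian A).toReal :=
    ENNReal.toReal_pos complexGaussian_annulus_pos.ne' (measure_ne_top _ _)
  refine ⟨(complexGaussian A).toReal * (c / (4 * M)) ^ (M - 1), by positivity,
    fun t ht0 ht1 => ?_⟩
  have htM0 : 0 ≤ t / (4 * M) := by positivity
  have htM1 : t / (4 * M) ≤ 1 := by rw [div_le_one (by positivity)]; linarith
  calc ENNReal.ofReal ((complexGaussian A).toReal * (c / (4 * M)) ^ (M - 1) * t ^ (M - 1))
      = complexGaussian A * ENNReal.ofReal (c * (t / (4 * M))) ^ (M - 1) := by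
        rw [mul_assoc, ENNReal.ofReal_mul hp.le, ENNReal.ofReal_toReal (measure_ne_top _ _),
          ← mul_pow, ENNReal.ofReal_pow (by positivity)]
        congr 3
        ring
    _ ≤ complexGaussian A * complexGaussian {z | ‖z‖ ^ 2 ≤ t / (4 * M)} ^ (M - 1) := by
        gcongr
        exact h _ htM0 htM1
    _ = ∏ j, complexGaussian (if j = i then A else {z : ℂ | ‖z‖ ^ 2 ≤ t / (4 * M)}) := by
        rw [← Finset.mul_prod_erase _ _ (Finset.mem_univ i), if_pos rfl]
        congr 1
        rw [Finset.prod_congr rfl (g := fun _ => complexGaussian {z : ℂ | ‖z‖ ^ 2 ≤ t / (4 * M)})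
          fun j hj => by rw [if_neg (Finset.ne_of_mem_erase hj)]]
        rw [Finset.prod_const, Finset.card_erase_of_mem (Finset.mem_univ i), Finset.card_univ,
          Fintype.card_fin]
    _ = channelLaw M {x | ∀ j, x j ∈ (if j = i then A else {z : ℂ | ‖z‖ ^ 2 ≤ t / (4 * M)})} :=
        (channelLaw_rectangle _ fun j => by
          split_ifs
          · exact hAm
          · exact measurableSet_le (by fun_prop) (by fun_prop)).symm
    _ ≤ _ := by
        refine measure_mono fun x hx => ?_
        have hi : x i ∈ A := by simpa using hx i
        have hsum : ∑ k ∈ Finset.univ.erase i, ‖x k‖ ^ 2 ≤ t / 4 := by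
          calc _ ≤ ∑ k ∈ Finset.univ.erase i, t / (4 * M) := by
                refine Finset.sum_le_sum fun k hk => ?_
                have := hx k
                rw [if_neg (Finset.ne_of_mem_erase hk)] at this
                exact this
            _ ≤ ∑ k : Fin M, t / (4 * M) :=
                Finset.sum_le_sum_of_subset_of_nonneg (Finset.erase_subset _ _)
                  fun _ _ _ => htM0
            _ = t / 4 := by
                rw [Finset.sum_const, Finset.card_univ, Fintype.card_fin, nsmul_eq_mul]
                field_simp
        have h4 := norm_sq_eq_add i x
        have h5 : 1 / 4 ≤ ‖x i‖ ^ 2 := hi.1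
        have h6 : ‖x i‖ ^ 2 ≤ 1 / 2 := hi.2
        have h7 : 0 ≤ ∑ k ∈ Finset.univ.erase i, ‖x k‖ ^ 2 :=
          Finset.sum_nonneg fun _ _ => by positivity
        exact ⟨by nlinarith [norm_nonneg x], by nlinarith⟩

end Rectangles

/-! ### The angle between complex lines. -/

section Angle

variable {M : ℕ}

/-- The squared sine of the angle between the complex lines spanned by `h` and `w`. -/
noncomputable def sinSq (h w : CVec M) : ℝ := 1 - ‖inner ℂ h w‖ ^ 2 / (‖h‖ ^ 2 * ‖w‖ ^ 2)

@[fun_prop]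
theorem measurable_sinSq {X : Type*} [MeasurableSpace X] {f g : X → CVec M} (hf : Measurable f)
    (hg : Measurable g) : Measurable fun x => sinSq (f x) (g x) := by
  unfold sinSq
  have : Measurable fun x => inner ℂ (f x) (g x) := hf.inner hg
  fun_prop

theorem sinSq_unitary (U : CVec M ≃ₗᵢ[ℂ] CVec M) (h w : CVec M) :
    sinSq (U h) (U w) = sinSq h w := by
  simp [sinSq, LinearIsometryEquiv.inner_map_map]

theorem sinSq_smul_right (h w : CVec M) {r : ℝ} (hr : r ≠ 0) : sinSq h (r • w) = sinSq h w := by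
  unfold sinSq
  have : inner ℂ h (r • w) = (r : ℂ) * inner ℂ h w := by
    rw [← Complex.coe_smul, inner_smul_right]
  rw [this, norm_mul, norm_smul, mul_pow, mul_pow, Complex.norm_real, mul_left_comm,
    mul_div_mul_left _ _ (by positivity)]

theorem sinSq_nonneg (h w : CVec M) : 0 ≤ sinSq h w := by
  rw [sinSq, sub_nonneg]
  refine div_le_one_of_le₀ ?_ (by positivity)
  rw [← mul_pow]
  exact pow_le_pow_left₀ (norm_nonneg _) (norm_inner_le_norm h w) 2

/-- Turns a cap centred on a coordinate axis into the cone whose Gaussian mass is estimated above.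
-/
theorem sinSq_single (i : Fin M) (a : ℂ) (ha : a ≠ 0) {x : CVec M} (hx : x ≠ 0) (t : ℝ) :
    sinSq (EuclideanSpace.single i a) x ≤ t ↔ ‖x‖ ^ 2 - ‖x i‖ ^ 2 ≤ t * ‖x‖ ^ 2 := by
  have h1 : 0 < ‖x‖ ^ 2 := by positivity
  have h2 : 0 < ‖a‖ ^ 2 := by positivity
  rw [sinSq, EuclideanSpace.inner_single_left, PiLp.norm_single, norm_mul, mul_pow,
    RCLike.norm_conj, mul_div_mul_left _ _ h2.ne', ← div_self h1.ne', ← sub_div, div_le_iff₀ h1]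

end Angle

/-! ### Gaussian model of the isotropic law; masses of caps and hyperplanes. -/

section Cap

variable {M : ℕ}

theorem channelLaw_ball_ne_zero (hM : 0 < M) : channelLaw M {x | ‖x‖ ≤ 1} ≠ 0 := by
  obtain ⟨c, hc, h⟩ := exists_le_channelLaw_cylinder (⟨0, hM⟩ : Fin M)
  have h1 := h 1 zero_le_one le_rfl
  intro h0
  have h2 := h1.trans (measure_mono (t := {x | ‖x‖ ≤ 1}) fun x hx => hx.1)
  rw [h0, nonpos_iff_eq_zero, ENNReal.ofReal_eq_zero] at h2
  simp only [one_pow, mul_one] at h2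
  linarith

theorem measurableSet_ball : MeasurableSet {x : CVec M | ‖x‖ ≤ 1} :=
  measurableSet_le (by fun_prop) (by fun_prop)

theorem measurable_normalize : Measurable fun x : CVec M => ‖x‖⁻¹ • x := by fun_prop

/-- The isotropic distribution is the law of the direction of a Gaussian vector conditioned to
lie in the unit ball. -/
theorem isIsotropic_normalize (hM : 0 < M) :
    IsIsotropic (((channelLaw M)[|{x | ‖x‖ ≤ 1}]).map fun x => ‖x‖⁻¹ • x) := by
  have hp : IsProbabilityMeasure ((channelLaw M)[|{x | ‖x‖ ≤ 1}]) :=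
    cond_isProbabilityMeasure (channelLaw_ball_ne_zero hM)
  refine ⟨Measure.isProbabilityMeasure_map measurable_normalize.aemeasurable, ?_, fun U => ?_⟩
  · rw [ae_map_iff measurable_normalize.aemeasurable
      (measurableSet_eq_fun (by fun_prop) (by fun_prop))]
    have hac : (channelLaw M)[|{x | ‖x‖ ≤ 1}] ≪ channelLaw M := cond_absolutelyContinuous
    filter_upwards [hac.ae_le (ae_channelLaw_ne_zero hM)] with x hx
    rw [norm_smul, norm_inv, norm_norm, inv_mul_cancel₀ (norm_ne_zero_iff.2 hx)]
  · have hU : Measurable U := U.continuous.measurable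
    rw [Measure.map_map hU measurable_normalize]
    have h1 : (U ∘ fun x : CVec M => ‖x‖⁻¹ • x) = (fun x : CVec M => ‖x‖⁻¹ • x) ∘ U := by
      ext1 x
      simp only [Function.comp, U.norm_map]
      rw [← Complex.coe_smul, ← Complex.coe_smul, map_smul]
    rw [h1, ← Measure.map_map measurable_normalize hU]
    congr 1
    -- The conditioning event is a ball, hence invariant under U, and so is the Gaussian law.
    rw [ProbabilityTheory.cond, Measure.map_smul]
    congr 1
    conv_rhs => rw [← channelLaw_map_unitary U]
    rw [Measure.restrict_map hU measurableSet_ball]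
    congr 2
    ext x
    simp

theorem IsIsotropic.apply_eq {μ : Measure (CVec M)} (hμ : IsIsotropic μ) (hM : 0 < M)
    {s : Set (CVec M)} (hs : MeasurableSet s) :
    μ s = (channelLaw M {x | ‖x‖ ≤ 1})⁻¹ *
      channelLaw M ({x | ‖x‖ ≤ 1} ∩ (fun x => ‖x‖⁻¹ • x) ⁻¹' s) := by
  rw [hμ.eq (isIsotropic_normalize hM), Measure.map_apply measurable_normalize hs,
    cond_apply measurableSet_ball]

/-- The mass of a spherical cap of squared angular radius `t` is of order `t ^ (M - 1)`. -/
theorem IsIsotropic.exists_cap_bounds {μ : Measure (CVec M)} (hμ : IsIsotropic μ) (hM : 0 < M) :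
    ∃ c C : ℝ, 0 < c ∧ 0 < C ∧ ∀ h : CVec M, h ≠ 0 → ∀ t : ℝ, 0 ≤ t → t ≤ 1 →
      ENNReal.ofReal (c * t ^ (M - 1)) ≤ μ {w | sinSq h w ≤ t} ∧
      μ {w | sinSq h w ≤ t} ≤ ENNReal.ofReal (C * t ^ (M - 1)) := by
  set i : Fin M := ⟨0, hM⟩
  obtain ⟨c, hc, hlow⟩ := exists_le_channelLaw_cylinder i
  set a := channelLaw M {x | ‖x‖ ≤ 1} with ha
  have ha0 : a⁻¹ ≠ 0 := ENNReal.inv_ne_zero.2 (measure_ne_top _ _)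
  have hat : a⁻¹ ≠ ⊤ := ENNReal.inv_ne_top.2 (channelLaw_ball_ne_zero hM)
  have hpos : 0 < a⁻¹.toReal := ENNReal.toReal_pos ha0 hat
  refine ⟨a⁻¹.toReal * c, a⁻¹.toReal * 4 ^ (M - 1), by positivity, by positivity,
    fun h hh t ht0 ht1 => ?_⟩
  -- Rotate h onto a coordinate axis and pass to the Gaussian model; scale invariance of `sinSq`
  -- removes the normalization.
  have key : μ {w | sinSq h w ≤ t} = a⁻¹ *
      channelLaw M {x | ‖x‖ ≤ 1 ∧ ‖x‖ ^ 2 - ‖x i‖ ^ 2 ≤ t * ‖x‖ ^ 2} := by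
    have hn : ((‖h‖ : ℝ) : ℂ) ≠ 0 := by simpa using hh
    obtain ⟨U, hU⟩ : ∃ U : CVec M ≃ₗᵢ[ℂ] CVec M,
        U h = EuclideanSpace.single i ((‖h‖ : ℝ) : ℂ) :=
      exists_unitary_map_eq (by simp)
    have hUm : Measurable U := U.continuous.measurable
    have hm : MeasurableSet {w : CVec M | sinSq (EuclideanSpace.single i ((‖h‖ : ℝ) : ℂ)) w ≤ t} :=
      measurableSet_le (by fun_prop) (by fun_prop)
    have h1 : μ {w | sinSq h w ≤ t} =
        μ {w | sinSq (EuclideanSpace.single i ((‖h‖ : ℝ) : ℂ)) w ≤ t} := by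
      conv_rhs => rw [← hμ.map_unitary U, Measure.map_apply hUm hm]
      congr 1
      ext w
      simp [← hU, sinSq_unitary]
    rw [h1, hμ.apply_eq hM hm]
    congr 1
    refine measure_congr ?_
    filter_upwards [ae_channelLaw_ne_zero hM] with x hx
    refine propext (and_congr Iff.rfl ?_)
    change sinSq _ (‖x‖⁻¹ • x) ≤ t ↔ ‖x‖ ^ 2 - ‖x i‖ ^ 2 ≤ t * ‖x‖ ^ 2
    rw [sinSq_smul_right _ _ (by simpa using hx), sinSq_single i _ hn hx]
  rw [key, mul_assoc, mul_assoc, ENNReal.ofReal_mul hpos.le, ENNReal.ofReal_mul hpos.le,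
    ENNReal.ofReal_toReal hat, ← mul_pow]
  exact ⟨by gcongr; exact hlow t ht0 ht1, by gcongr; exact channelLaw_cylinder_le i ht0⟩

/-- The isotropic distribution does not charge hyperplanes. -/
theorem IsIsotropic.hyperplane_eq_zero {μ : Measure (CVec M)} (hμ : IsIsotropic μ) (hM : 0 < M)
    {u : CVec M} (hu : u ≠ 0) : μ {w | inner ℂ u w = 0} = 0 := by
  set i : Fin M := ⟨0, hM⟩
  obtain ⟨U, hU⟩ : ∃ U : CVec M ≃ₗᵢ[ℂ] CVec M,
      U u = EuclideanSpace.single i ((‖u‖ : ℝ) : ℂ) :=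
    exists_unitary_map_eq (by simp)
  have hn : ((‖u‖ : ℝ) : ℂ) ≠ 0 := by simpa using hu
  have hUm : Measurable U := U.continuous.measurable
  have hm : MeasurableSet {w : CVec M | w i = 0} :=
    measurableSet_eq_fun (by fun_prop) (by fun_prop)
  have h1 : μ {w | inner ℂ u w = 0} = μ {w | w i = 0} := by
    conv_rhs => rw [← hμ.map_unitary U, Measure.map_apply hUm hm]
    congr 1
    ext w
    rw [Set.mem_ofPred_eq, ← U.inner_map_map, hU, EuclideanSpace.inner_single_left]
    simp [hu]
  rw [h1, hμ.apply_eq hM hm]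
  refine mul_eq_zero_of_right _ (measure_mono_null (fun x hx => ?_) (channelLaw_coord_eq_zero i))
  have h2 : ‖x‖⁻¹ • x i = 0 := hx.2
  rcases smul_eq_zero.1 h2 with h3 | h3
  · have : x = 0 := by simpa using h3
    simp [this]
  · exact h3

end Cap

/-! ### Almost sure linear independence of isotropic vectors. -/

section Independence

variable {M : ℕ}

theorem IsIsotropic.subspace_eq_zero {μ : Measure (CVec M)} (hμ : IsIsotropic μ) (hM : 0 < M)
    {W : Submodule ℂ (CVec M)} (hW : W ≠ ⊤) : μ (W : Set (CVec M)) = 0 := by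
  have hW' : Wᗮ ≠ ⊥ := fun h => hW (Submodule.orthogonal_eq_bot_iff.1 h)
  obtain ⟨u, hu, hu0⟩ := Submodule.exists_mem_ne_zero_of_ne_bot hW'
  exact measure_mono_null (fun w hw => Submodule.inner_left_of_mem_orthogonal hw hu)
    (hμ.hyperplane_eq_zero hM hu0)

theorem measurableSet_linearIndependent (k : ℕ) :
    MeasurableSet {g : Fin k → CVec M | LinearIndependent ℂ g} :=
  isOpen_setOfPred_linearIndependent.measurableSet

/-- At most `M` independent isotropic vectors are almost surely linearly independent. -/
theorem IsIsotropic.ae_linearIndependent {μ : Measure (CVec M)} (hμ : IsIsotropic μ)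
    (hM : 0 < M) (k : ℕ) (hk : k ≤ M) :
    ∀ᵐ g ∂(Measure.pi fun _ : Fin k => μ), LinearIndependent ℂ g := by
  have := hμ.isProbabilityMeasure
  induction k with
  | zero => exact ae_of_all _ fun g => linearIndependent_empty_type
  | succ k ih =>
    have ih := ih (by omega)
    have hmp := measurePreserving_piFinSuccAbove (fun _ : Fin (k + 1) => μ) 0
    set s : Set (CVec M × (Fin k → CVec M)) :=
      {p | ¬ LinearIndependent ℂ (Fin.cons p.1 p.2 : Fin (k + 1) → CVec M)} with hs
    have hsm : MeasurableSet s := by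
      have : Measurable fun p : CVec M × (Fin k → CVec M) =>
          (Fin.cons p.1 p.2 : Fin (k + 1) → CVec M) := by
        refine measurable_pi_iff.2 fun i => ?_
        refine Fin.cases ?_ (fun j => ?_) i
        · exact measurable_fst
        · exact (measurable_pi_apply j).comp measurable_snd
      exact (this (measurableSet_linearIndependent (k + 1))).compl
    -- Fubini with the tail g frozen: the first vector would have to lie in the span of g, a proper
    -- subspace since its dimension k is less than M.
    have hs0 : (μ.prod (Measure.pi fun _ : Fin k => μ)) s = 0 := by
      rw [Measure.prod_apply_symm hsm, lintegral_eq_zero_iff (measurable_measure_prodMk_right hsm)]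
      filter_upwards [ih] with g hg
      refine measure_mono_null (t := (Submodule.span ℂ (Set.range g) : Set (CVec M)))
        (fun x hx => ?_) (hμ.subspace_eq_zero hM fun htop => ?_)
      · by_contra hxs
        exact hx (linearIndependent_finCons.2 ⟨hg, hxs⟩)
      · have h1 := finrank_span_eq_card hg
        rw [htop, finrank_top, finrank_euclideanSpace, Fintype.card_fin, Fintype.card_fin] at h1
        omega
    have h2 := hmp.quasiMeasurePreserving.ae (p := fun p => p ∉ s)
      (measure_eq_zero_iff_ae_notMem.1 hs0)
    filter_upwards [h2] with g hg
    have h3 : LinearIndependent ℂ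
        (Fin.cons (g 0) (fun j => g (Fin.succ j)) : Fin (k + 1) → CVec M) := by
      by_contra hcon
      exact hg hcon
    rwa [show (Fin.cons (g 0) (fun j => g (Fin.succ j)) : Fin (k + 1) → CVec M) = g from
      Fin.cons_self_tail g] at h3

end Independence

/-! ### Deterministic SINR bounds for zero-forcing. -/

section ZeroForcing

variable {M : ℕ} {g : Fin M → CVec M}

theorem isUnit_det_channelMatrix (hg : LinearIndependent ℂ g) :
    IsUnit (channelMatrix g).det := by
  have h1 : channelMatrix g = (starRingEnd ℂ).mapMatrix (Matrix.of fun i k => g i k) := by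
    ext i k; simp [channelMatrix]
  have h2 : LinearIndependent ℂ (Matrix.of fun i k => g i k).row :=
    hg.map' (WithLp.linearEquiv 2 ℂ (Fin M → ℂ)).toLinearMap (LinearEquiv.ker _)
  rw [h1, ← RingHom.map_det]
  exact (((Matrix.isUnit_iff_isUnit_det _).1
    (Matrix.linearIndependent_rows_iff_isUnit.1 h2))).map (starRingEnd ℂ)

/-- The columns of the inverse form the basis dual to g. -/
theorem inner_inverseColumn (hg : LinearIndependent ℂ g) (k j : Fin M) :
    inner ℂ (g k) (inverseColumn g j) = if k = j then 1 else 0 := by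
  have h := congrFun₂ (Matrix.mul_nonsing_inv _ (isUnit_det_channelMatrix hg)) k j
  rw [Matrix.mul_apply, Matrix.one_apply] at h
  rw [← h, PiLp.inner_apply]
  simp [channelMatrix, inverseColumn, mul_comm]

theorem eq_sum_inverseColumn (hg : LinearIndependent ℂ g) (h : CVec M) :
    h = ∑ k, inner ℂ (inverseColumn g k) h • g k := by
  ext m
  have h1 : ∀ l, ∑ k, (channelMatrix g)⁻¹ l k * star (g k m) = if l = m then 1 else 0 := by
    intro l
    have := congrFun₂ (Matrix.nonsing_inv_mul _ (isUnit_det_channelMatrix hg)) l m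
    rw [Matrix.mul_apply, Matrix.one_apply] at this
    rw [← this]
    simp [channelMatrix]
  have h2 : ∀ l, ∑ k, star ((channelMatrix g)⁻¹ l k) * g k m = if l = m then 1 else 0 := by
    intro l
    have := congrArg star (h1 l)
    rw [star_sum] at this
    simpa [mul_comm, apply_ite] using this
  calc h m = ∑ l, h l * ∑ k, star ((channelMatrix g)⁻¹ l k) * g k m := by
        simp only [h2]; simp
    _ = ∑ k, (∑ l, h l * star ((channelMatrix g)⁻¹ l k)) * g k m := by
        simp only [Finset.mul_sum, Finset.sum_mul]
        rw [Finset.sum_comm]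
        simp only [mul_assoc]
    _ = _ := by
        simp [PiLp.inner_apply, inverseColumn]

theorem norm_zeroForcing_le (g : Fin M → CVec M) (i : Fin M) : ‖zeroForcing g i‖ ≤ 1 := by
  rw [zeroForcing, norm_smul, Complex.norm_real, norm_inv, norm_norm]
  exact inv_mul_le_one

theorem norm_inner_inverseColumn (h : CVec M) (j : Fin M) :
    ‖inner ℂ h (inverseColumn g j)‖ = ‖inverseColumn g j‖ * ‖inner ℂ h (zeroForcing g j)‖ := by
  rcases eq_or_ne (inverseColumn g j) 0 with h0 | h0
  · simp [h0]
  · rw [zeroForcing, inner_smul_right, norm_mul, Complex.norm_real, norm_inv, norm_norm,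
      mul_inv_cancel_left₀ (norm_ne_zero_iff.2 h0)]

/-- The squared Frobenius norm of the inverse of the matrix with rows `(g i)†`. -/
noncomputable def inverseEnergy (g : Fin M → CVec M) : ℝ := ∑ j, ‖inverseColumn g j‖ ^ 2

theorem inner_zeroForcing_of_ne (hg : LinearIndependent ℂ g) {i j : Fin M} (hij : i ≠ j) :
    inner ℂ (g i) (zeroForcing g j) = 0 := by
  rw [zeroForcing, inner_smul_right, inner_inverseColumn hg, if_neg hij, mul_zero]

theorem norm_sq_sub_proj {h u : CVec M} (hu : ‖u‖ = 1) (hh : h ≠ 0) :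
    ‖h - inner ℂ u h • u‖ ^ 2 = sinSq h u * ‖h‖ ^ 2 := by
  have h1 : h = inner ℂ u h • u + (h - inner ℂ u h • u) := by abel
  have h2 : inner ℂ (inner ℂ u h • u) (h - inner ℂ u h • u) = 0 := by
    rw [inner_sub_right, inner_smul_left, inner_smul_left, inner_smul_right,
      inner_self_eq_norm_sq_to_K, hu]
    simp
  have h3 := norm_add_sq_eq_norm_sq_add_norm_sq_of_inner_eq_zero _ _ h2
  rw [← h1, norm_smul, hu, mul_one] at h3
  have h4 : ‖h‖ ≠ 0 := norm_ne_zero_iff.2 hh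
  rw [sinSq, hu, norm_inner_symm h u]
  field_simp
  nlinarith

theorem norm_sq_sub_proj_le {h u : CVec M} (hu : ‖u‖ = 1) (c : ℂ) :
    ‖h - inner ℂ u h • u‖ ^ 2 ≤ ‖h - c • u‖ ^ 2 := by
  have h1 : h - c • u = (inner ℂ u h - c) • u + (h - inner ℂ u h • u) := by
    rw [sub_smul]; abel
  have h2 : inner ℂ ((inner ℂ u h - c) • u) (h - inner ℂ u h • u) = 0 := by
    rw [inner_sub_right, inner_smul_left, inner_smul_left, inner_smul_right,
      inner_self_eq_norm_sq_to_K, hu]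
    simp
  have h3 := norm_add_sq_eq_norm_sq_add_norm_sq_of_inner_eq_zero _ _ h2
  rw [← h1] at h3
  nlinarith [sq_nonneg ‖(inner ℂ u h - c) • u‖]

/-- The interference caused by the quantization error cannot be small. -/
theorem sinSq_mul_le_interference (hg : LinearIndependent ℂ g) (hn : ∀ j, ‖g j‖ = 1)
    {h : CVec M} (hh : h ≠ 0) (i : Fin M) :
    sinSq h (g i) * ‖h‖ ^ 2 ≤
      inverseEnergy g * ∑ j ∈ Finset.univ.erase i, ‖inner ℂ h (zeroForcing g j)‖ ^ 2 := by
  rw [← norm_sq_sub_proj (hn i) hh]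
  -- Replace the orthogonal projection onto g i by the g i-term of the dual basis expansion. The
  -- residual then involves only the coefficients with j ≠ i, which are the interference amplitudes
  -- times ‖inverseColumn g j‖; Cauchy–Schwarz concludes.
  refine (norm_sq_sub_proj_le (hn i) (inner ℂ (inverseColumn g i) h)).trans ?_
  have h1 : h - inner ℂ (inverseColumn g i) h • g i =
      ∑ j ∈ Finset.univ.erase i, inner ℂ (inverseColumn g j) h • g j := by
    rw [sub_eq_iff_eq_add', Finset.add_sum_erase _
      (fun j => inner ℂ (inverseColumn g j) h • g j) (Finset.mem_univ i)]
    exact eq_sum_inverseColumn hg h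
  have h2 : ‖h - inner ℂ (inverseColumn g i) h • g i‖ ≤
      ∑ j ∈ Finset.univ.erase i, ‖inverseColumn g j‖ * ‖inner ℂ h (zeroForcing g j)‖ := by
    rw [h1]
    refine (norm_sum_le _ _).trans (Finset.sum_le_sum fun j _ => ?_)
    rw [norm_smul, hn j, mul_one, norm_inner_symm, norm_inner_inverseColumn]
  calc _ ≤ (∑ j ∈ Finset.univ.erase i,
        ‖inverseColumn g j‖ * ‖inner ℂ h (zeroForcing g j)‖) ^ 2 :=
        pow_le_pow_left₀ (norm_nonneg _) h2 2
    _ ≤ (∑ j ∈ Finset.univ.erase i, ‖inverseColumn g j‖ ^ 2) *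
        ∑ j ∈ Finset.univ.erase i, ‖inner ℂ h (zeroForcing g j)‖ ^ 2 :=
        Finset.sum_mul_sq_le_sq_mul_sq _ _ _
    _ ≤ _ := by
        refine mul_le_mul_of_nonneg_right ?_ (Finset.sum_nonneg fun _ _ => by positivity)
        exact Finset.sum_le_sum_of_subset_of_nonneg (Finset.erase_subset _ _)
          fun _ _ _ => by positivity

/-- The beam of user j is orthogonal to g i, so it sees only the component of h orthogonal to g i.
-/
theorem interference_le (hg : LinearIndependent ℂ g) (hn : ∀ j, ‖g j‖ = 1)
    {h : CVec M} (hh : h ≠ 0) {i j : Fin M} (hij : i ≠ j) :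
    ‖inner ℂ h (zeroForcing g j)‖ ^ 2 ≤ sinSq h (g i) * ‖h‖ ^ 2 := by
  rw [← norm_sq_sub_proj (hn i) hh]
  have h1 : inner ℂ h (zeroForcing g j) =
      inner ℂ (h - inner ℂ (g i) h • g i) (zeroForcing g j) := by
    rw [inner_sub_left, inner_smul_left, inner_zeroForcing_of_ne hg hij, mul_zero, sub_zero]
  rw [h1]
  refine pow_le_pow_left₀ (norm_nonneg _) ?_ 2
  exact (norm_inner_le_norm _ _).trans
    (mul_le_of_le_one_right (norm_nonneg _) (norm_zeroForcing_le g j))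

theorem sq_norm_inverseColumn_le (g : Fin M → CVec M) (i : Fin M) :
    ‖inverseColumn g i‖ ^ 2 ≤ inverseEnergy g :=
  Finset.single_le_sum (f := fun j => ‖inverseColumn g j‖ ^ 2) (fun _ _ => by positivity)
    (Finset.mem_univ i)

theorem one_le_norm_inverseColumn (hg : LinearIndependent ℂ g) (hn : ∀ j, ‖g j‖ = 1)
    (i : Fin M) : 1 ≤ ‖inverseColumn g i‖ := by
  have h1 := norm_inner_le_norm (𝕜 := ℂ) (g i) (inverseColumn g i)
  rw [inner_inverseColumn hg, if_pos rfl, hn, one_mul, norm_one] at h1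
  exact h1

/-- Write h as its projection on g i plus r, and let s be the norm of the i-th dual vector, which
pairs to 1 with g i. Hypothesis `ht` says that s‖r‖ ≤ ‖h‖/4 (whence 16 = 4²); as s ≥ 1, the error
terms ‖r‖ and s‖r‖ together consume at most half of ‖h‖. -/
theorem le_signal (hg : LinearIndependent ℂ g) (hn : ∀ j, ‖g j‖ = 1)
    {h : CVec M} (hh : h ≠ 0) (i : Fin M) (ht : 16 * (inverseEnergy g * sinSq h (g i)) ≤ 1) :
    ‖h‖ ^ 2 ≤ 4 * inverseEnergy g * ‖inner ℂ h (zeroForcing g i)‖ ^ 2 := by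
  set s := ‖inverseColumn g i‖
  set r := h - inner ℂ (g i) h • g i with hr
  have hs : 1 ≤ s := one_le_norm_inverseColumn hg hn i
  have hsK : s ^ 2 ≤ inverseEnergy g := sq_norm_inverseColumn_le g i
  have hr2 : ‖r‖ ^ 2 = sinSq h (g i) * ‖h‖ ^ 2 := norm_sq_sub_proj (hn i) hh
  have hs0 := sinSq_nonneg h (g i)
  have hrs : 4 * (s * ‖r‖) ≤ ‖h‖ := by
    refine le_of_sq_le_sq ?_ (norm_nonneg _)
    calc (4 * (s * ‖r‖)) ^ 2 = 16 * (s ^ 2 * sinSq h (g i)) * ‖h‖ ^ 2 := by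
          rw [mul_pow, mul_pow, hr2]; ring
      _ ≤ 16 * (inverseEnergy g * sinSq h (g i)) * ‖h‖ ^ 2 := by gcongr
      _ ≤ 1 * ‖h‖ ^ 2 := by gcongr
      _ = ‖h‖ ^ 2 := one_mul _
  have h1 : ‖h‖ - ‖r‖ ≤ ‖inner ℂ (g i) h‖ := by
    have : h = inner ℂ (g i) h • g i + r := by rw [hr]; abel
    have h2 : ‖h‖ ≤ ‖inner ℂ (g i) h • g i‖ + ‖r‖ := by
      conv_lhs => rw [this]
      exact norm_add_le _ _
    rw [norm_smul, hn i, mul_one] at h2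
    linarith
  have h3 : ‖inner ℂ (g i) h‖ ≤ ‖inner ℂ h (inverseColumn g i)‖ + ‖r‖ * s := by
    have h4 : inner ℂ h (inverseColumn g i) =
        starRingEnd ℂ (inner ℂ (g i) h) + inner ℂ r (inverseColumn g i) := by
      rw [hr, inner_sub_left, inner_smul_left, inner_inverseColumn hg, if_pos rfl]
      ring
    have h5 : starRingEnd ℂ (inner ℂ (g i) h) =
        inner ℂ h (inverseColumn g i) - inner ℂ r (inverseColumn g i) := by rw [h4]; ring
    rw [← RCLike.norm_conj, h5]
    exact (norm_sub_le _ _).trans (by gcongr; exact norm_inner_le_norm _ _)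
  rw [norm_inner_inverseColumn] at h3
  have h6 : ‖h‖ ≤ 2 * (s * ‖inner ℂ h (zeroForcing g i)‖) := by
    nlinarith [norm_nonneg r]
  calc ‖h‖ ^ 2 ≤ (2 * (s * ‖inner ℂ h (zeroForcing g i)‖)) ^ 2 :=
        pow_le_pow_left₀ (norm_nonneg _) h6 2
    _ = 4 * s ^ 2 * ‖inner ℂ h (zeroForcing g i)‖ ^ 2 := by ring
    _ ≤ _ := by gcongr

/-- With the noise dropped, P and ‖h i‖² cancel between signal and interference. -/
theorem sinr_zeroForcing_le (hg : LinearIndependent ℂ g) (hn : ∀ j, ‖g j‖ = 1)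
    {h : Fin M → CVec M} {i : Fin M} (hh : h i ≠ 0) {P t : ℝ} (hP : 0 < P) (ht : 0 < t)
    (hs : t ≤ sinSq (h i) (g i)) :
    sinr P h (zeroForcing g) i ≤ inverseEnergy g / t := by
  have hM : (0 : ℝ) < M := by exact_mod_cast Fin.pos i
  have hK : 1 ≤ inverseEnergy g := by
    nlinarith [sq_norm_inverseColumn_le g i, one_le_norm_inverseColumn hg hn i]
  have h1 := sinSq_mul_le_interference hg hn hh i
  have h2 : ‖inner ℂ (h i) (zeroForcing g i)‖ ^ 2 ≤ ‖h i‖ ^ 2 :=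
    pow_le_pow_left₀ (norm_nonneg _) ((norm_inner_le_norm _ _).trans
      (mul_le_of_le_one_right (norm_nonneg _) (norm_zeroForcing_le g i))) 2
  rw [sinr, ← Finset.mul_sum]
  set I := ∑ j ∈ Finset.univ.erase i, ‖inner ℂ (h i) (zeroForcing g j)‖ ^ 2
  have hI : 0 ≤ I := Finset.sum_nonneg fun _ _ => by positivity
  rw [div_le_div_iff₀ (by positivity) ht]
  have h3 : t * ‖h i‖ ^ 2 ≤ inverseEnergy g * I := le_trans (by gcongr) h1
  calc P / M * ‖inner ℂ (h i) (zeroForcing g i)‖ ^ 2 * t ≤ P / M * ‖h i‖ ^ 2 * t := by gcongr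
    _ = P / M * (t * ‖h i‖ ^ 2) := by ring
    _ ≤ P / M * (inverseEnergy g * I) := by gcongr
    _ ≤ inverseEnergy g * (1 + P / M * I) := by nlinarith

/-- The hypotheses 1 ≤ P t and 1 ≤ k‖h i‖² make the noise at most P t k‖h i‖², comparable to the
interference bound. In 8 M k² t, a factor 2 adds noise and interference, 4k is the signal loss,
another k is the noise comparison, and M undoes the power split. -/
theorem le_sinr_zeroForcing (hg : LinearIndependent ℂ g) (hn : ∀ j, ‖g j‖ = 1)
    {h : Fin M → CVec M} {i : Fin M} {P t k : ℝ} (hP : 0 < P) (ht : 0 < t)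
    (hPt : 1 ≤ P * t) (hs : sinSq (h i) (g i) ≤ t) (hk : 1 ≤ k) (hK : inverseEnergy g ≤ k)
    (hhk : 1 ≤ k * ‖h i‖ ^ 2) (htk : 16 * (k * t) ≤ 1) :
    1 / (8 * M * k ^ 2 * t) ≤ sinr P h (zeroForcing g) i := by
  have hM : (1 : ℝ) ≤ M := by exact_mod_cast Fin.pos i
  have hh : h i ≠ 0 := fun h0 => by
    rw [h0] at hhk
    norm_num at hhk
  have hs0 := sinSq_nonneg (h i) (g i)
  have h1 : ‖h i‖ ^ 2 ≤ 4 * k * ‖inner ℂ (h i) (zeroForcing g i)‖ ^ 2 := by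
    refine (le_signal hg hn hh i (le_trans ?_ htk)).trans (by gcongr)
    gcongr
  rw [sinr, ← Finset.mul_sum]
  have hI : ∑ j ∈ Finset.univ.erase i, ‖inner ℂ (h i) (zeroForcing g j)‖ ^ 2 ≤
      M * (t * ‖h i‖ ^ 2) := by
    calc _ ≤ ∑ j ∈ Finset.univ.erase i, t * ‖h i‖ ^ 2 := by
          refine Finset.sum_le_sum fun j hj => ?_
          exact (interference_le hg hn hh (Finset.ne_of_mem_erase hj).symm).trans (by gcongr)
      _ ≤ ∑ j : Fin M, t * ‖h i‖ ^ 2 :=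
          Finset.sum_le_sum_of_subset_of_nonneg (Finset.erase_subset _ _)
            fun _ _ _ => by positivity
      _ = _ := by
          rw [Finset.sum_const, Finset.card_univ, Fintype.card_fin, nsmul_eq_mul]
  have hI0 : 0 ≤ ∑ j ∈ Finset.univ.erase i, ‖inner ℂ (h i) (zeroForcing g j)‖ ^ 2 :=
    Finset.sum_nonneg fun _ _ => by positivity
  set I := ∑ j ∈ Finset.univ.erase i, ‖inner ℂ (h i) (zeroForcing g j)‖ ^ 2
  set x := ‖h i‖ ^ 2
  rw [div_le_div_iff₀ (by positivity) (by positivity)]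
  have h2 : P / M * I ≤ P * t * x := by
    calc P / M * I ≤ P / M * (M * (t * x)) := by gcongr
      _ = P * t * x := by field_simp
  have hx : x ≤ k * x := le_mul_of_one_le_left (by positivity) hk
  calc 1 * (1 + P / M * I) ≤ P * t * (k * x) + P * t * x := by
        nlinarith
    _ ≤ 2 * (P * t) * k * x := by
        nlinarith [mul_le_mul_of_nonneg_left hx (by positivity : 0 ≤ P * t)]
    _ ≤ 2 * (P * t) * k * (4 * k * ‖inner ℂ (h i) (zeroForcing g i)‖ ^ 2) := by gcongr
    _ = _ := by field_simp; ring

end ZeroForcing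

/-! ### Law of the quantized channels. -/

section Quantization

variable {M B : ℕ}

theorem mem_maximizers {h : CVec M} {w : Codebook M B} {j : Fin (2 ^ B)} :
    j ∈ maximizers h w ↔ ∀ k, ‖inner ℂ h (w k)‖ ≤ ‖inner ℂ h (w j)‖ := by
  classical
  simp [maximizers]

theorem feedbackIndex_eq_iff {h : CVec M} {w : Codebook M B} {j : Fin (2 ^ B)} :
    feedbackIndex h w = j ↔
      (∀ k, ‖inner ℂ h (w k)‖ ≤ ‖inner ℂ h (w j)‖) ∧
        ∀ l, l < j → ¬ ∀ k, ‖inner ℂ h (w k)‖ ≤ ‖inner ℂ h (w l)‖ := by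
  simp only [← mem_maximizers]
  constructor
  · rintro rfl
    exact ⟨Finset.min'_mem _ _, fun l hl hm => absurd (Finset.min'_le _ _ hm) (not_le.2 hl)⟩
  · rintro ⟨hj, hl⟩
    refine le_antisymm (Finset.min'_le _ _ hj) (not_lt.1 fun hlt => ?_)
    exact hl _ hlt (Finset.min'_mem _ _)

theorem norm_inner_le_quantize (h : CVec M) (w : Codebook M B) (k : Fin (2 ^ B)) :
    ‖inner ℂ h (w k)‖ ≤ ‖inner ℂ h (quantize h w)‖ :=
  mem_maximizers.1 (Finset.min'_mem _ (maximizers_nonempty h w)) k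

theorem measurable_feedbackIndex :
    Measurable fun p : CVec M × Codebook M B => feedbackIndex p.1 p.2 := by
  refine measurable_to_countable' fun j => ?_
  have hm : ∀ k, Measurable fun p : CVec M × Codebook M B => ‖inner ℂ p.1 (p.2 k)‖ := fun k => by
    have h1 : Measurable fun p : CVec M × Codebook M B => p.2 k :=
      (measurable_pi_apply k).comp measurable_snd
    exact (Measurable.inner (𝕜 := ℂ) measurable_fst h1).norm
  have hA : ∀ j, MeasurableSet {p : CVec M × Codebook M B |
      ∀ k, ‖inner ℂ p.1 (p.2 k)‖ ≤ ‖inner ℂ p.1 (p.2 j)‖} := fun j => by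
    rw [Set.ofPred_forall]
    exact MeasurableSet.iInter fun k => measurableSet_le (hm k) (hm j)
  have heq : (fun p : CVec M × Codebook M B => feedbackIndex p.1 p.2) ⁻¹' {j} =
      {p | ∀ k, ‖inner ℂ p.1 (p.2 k)‖ ≤ ‖inner ℂ p.1 (p.2 j)‖} ∩
        ⋂ l, ⋂ (_ : l < j), {p | ∀ k, ‖inner ℂ p.1 (p.2 k)‖ ≤ ‖inner ℂ p.1 (p.2 l)‖}ᶜ := by
    ext p
    rw [Set.mem_preimage, Set.mem_singleton_iff, feedbackIndex_eq_iff]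
    simp
  rw [heq]
  exact (hA j).inter (MeasurableSet.iInter fun l => MeasurableSet.iInter fun _ => (hA l).compl)

theorem measurable_quantize :
    Measurable fun p : CVec M × Codebook M B => quantize p.1 p.2 := by
  have h1 : Measurable fun q : Codebook M B × Fin (2 ^ B) => q.1 q.2 :=
    measurable_from_prod_countable_left fun j => measurable_pi_apply j
  exact h1.comp (measurable_snd.prodMk measurable_feedbackIndex)

theorem quantize_unitary (U : CVec M ≃ₗᵢ[ℂ] CVec M) (h : CVec M) (w : Codebook M B) :
    quantize (U h) (fun j => U (w j)) = U (quantize h w) := by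
  have : feedbackIndex (U h) (fun j => U (w j)) = feedbackIndex h w := by
    rw [feedbackIndex_eq_iff]
    simp only [U.inner_map_map]
    exact feedbackIndex_eq_iff.1 rfl
  rw [quantize, quantize, this]

/-- The joint law of the channel vector and the codebook of one user. -/
noncomputable def userLaw (μ : Measure (CVec M)) (B : ℕ) : Measure (CVec M × Codebook M B) :=
  (channelLaw M).prod (Measure.pi fun _ => μ)

instance (μ : Measure (CVec M)) [IsProbabilityMeasure μ] (B : ℕ) :
    IsProbabilityMeasure (userLaw μ B) := by
  unfold userLaw; infer_instance

instance (μ : Measure (CVec M)) [IsProbabilityMeasure μ] (B : ℕ) :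
    IsProbabilityMeasure (systemLaw μ B) := by
  unfold systemLaw; infer_instance

theorem IsIsotropic.ae_codebook_norm {μ : Measure (CVec M)} (hμ : IsIsotropic μ) :
    ∀ᵐ w ∂(Measure.pi fun _ : Fin (2 ^ B) => μ), ∀ j, ‖w j‖ = 1 := by
  have := hμ.isProbabilityMeasure
  rw [ae_all_iff]
  exact fun j => (Measure.quasiMeasurePreserving_eval (fun _ : Fin (2 ^ B) => μ) j).ae
    hμ.norm_eq_one

/-- The quantized channel is again isotropic. -/
theorem IsIsotropic.map_quantize {μ : Measure (CVec M)} (hμ : IsIsotropic μ) (B : ℕ) :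
    (userLaw μ B).map (fun p => quantize p.1 p.2) = μ := by
  have := hμ.isProbabilityMeasure
  -- By uniqueness, unit norm and unitary invariance are enough. Rotating the channel and the whole
  -- codebook preserves their joint law and rotates the selected word.
  refine IsIsotropic.eq ⟨Measure.isProbabilityMeasure_map measurable_quantize.aemeasurable, ?_,
    fun U => ?_⟩ hμ
  · rw [ae_map_iff measurable_quantize.aemeasurable
      (measurableSet_eq_fun (by fun_prop) (by fun_prop))]
    have h1 : ∀ᵐ p ∂(userLaw μ B), ∀ j, ‖p.2 j‖ = 1 :=
      Measure.quasiMeasurePreserving_snd.ae hμ.ae_codebook_norm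
    filter_upwards [h1] with p hp
    exact hp _
  · have hU : Measurable U := U.continuous.measurable
    have hU' : Measurable fun (w : Codebook M B) j => U (w j) :=
      measurable_pi_iff.2 fun j => hU.comp (measurable_pi_apply j)
    rw [Measure.map_map hU measurable_quantize]
    have h1 : (U ∘ fun p : CVec M × Codebook M B => quantize p.1 p.2) =
        (fun p : CVec M × Codebook M B => quantize p.1 p.2) ∘
          Prod.map U (fun w j => U (w j)) := by
      ext1 p
      exact (quantize_unitary U p.1 p.2).symm
    rw [h1, ← Measure.map_map measurable_quantize (hU.prodMap hU'), userLaw,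
      ← Measure.map_prod_map _ _ hU hU', channelLaw_map_unitary]
    have : IsProbabilityMeasure (μ.map U) := Measure.isProbabilityMeasure_map hU.aemeasurable
    rw [Measure.pi_map_pi (μ := fun _ : Fin (2 ^ B) => μ) (f := fun _ => U)
      (fun _ => hU.aemeasurable), hμ.map_unitary]

theorem systemLaw_measurePreserving_pairs (μ : Measure (CVec M)) [IsProbabilityMeasure μ]
    (B : ℕ) :
    MeasurePreserving (fun (x : (Fin M → CVec M) × (Fin M → Codebook M B)) i => (x.1 i, x.2 i))
      (systemLaw μ B) (Measure.pi fun _ => userLaw μ B) :=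
  (measurePreserving_arrowProdEquivProdArrow (CVec M) (Codebook M B) (Fin M)
    (fun _ => channelLaw M) (fun _ => Measure.pi fun _ => μ)).symm

theorem systemLaw_measurePreserving_user (μ : Measure (CVec M)) [IsProbabilityMeasure μ]
    (B : ℕ) (i : Fin M) :
    MeasurePreserving (fun x : (Fin M → CVec M) × (Fin M → Codebook M B) => (x.1 i, x.2 i))
      (systemLaw μ B) (userLaw μ B) :=
  (measurePreserving_eval (fun _ : Fin M => userLaw μ B) i).comp
    (systemLaw_measurePreserving_pairs μ B)

theorem systemLaw_measurePreserving_channel (μ : Measure (CVec M)) [IsProbabilityMeasure μ]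
    (B : ℕ) (i : Fin M) :
    MeasurePreserving (fun x : (Fin M → CVec M) × (Fin M → Codebook M B) => x.1 i)
      (systemLaw μ B) (channelLaw M) :=
  measurePreserving_fst.comp (systemLaw_measurePreserving_user μ B i)

/-- The quantized channels are independent and isotropic, whatever the codebook size. -/
theorem IsIsotropic.measurePreserving_quantize {μ : Measure (CVec M)} (hμ : IsIsotropic μ)
    (B : ℕ) :
    MeasurePreserving (fun (x : (Fin M → CVec M) × (Fin M → Codebook M B)) i =>
      quantize (x.1 i) (x.2 i)) (systemLaw μ B) (Measure.pi fun _ => μ) := by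
  have := hμ.isProbabilityMeasure
  have h1 : MeasurePreserving (fun p : CVec M × Codebook M B => quantize p.1 p.2)
      (userLaw μ B) μ := ⟨measurable_quantize, hμ.map_quantize B⟩
  have h2 : MeasurePreserving
      (fun (y : Fin M → CVec M × Codebook M B) i => quantize (y i).1 (y i).2)
      (Measure.pi fun _ => userLaw μ B) (Measure.pi fun _ => μ) :=
    measurePreserving_pi _ _ fun _ => h1
  have h3 := h2.comp (systemLaw_measurePreserving_pairs μ B)
  rw [Function.comp_def] at h3
  exact h3

end Quantization

/-! ### Two-sided tail bounds for the quantization error. -/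

section QuantizationError

variable {M : ℕ}

/-- Union bound over the 2^B codewords. -/
theorem IsIsotropic.measure_sinSq_quantize_le {μ : Measure (CVec M)} (hμ : IsIsotropic μ)
    (hM : 0 < M) (B : ℕ) {t a : ℝ}
    (hcap : ∀ h : CVec M, h ≠ 0 → μ {w | sinSq h w ≤ t} ≤ ENNReal.ofReal a) :
    userLaw μ B {p | sinSq p.1 (quantize p.1 p.2) ≤ t} ≤ ENNReal.ofReal (2 ^ B * a) := by
  have := hμ.isProbabilityMeasure
  have hm : ∀ j, Measurable fun p : CVec M × Codebook M B => p.2 j := fun j =>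
    (measurable_pi_apply j).comp measurable_snd
  have hj : ∀ j, userLaw μ B {p | sinSq p.1 (p.2 j) ≤ t} ≤ ENNReal.ofReal a := fun j => by
    have hms : MeasurableSet {p : CVec M × Codebook M B | sinSq p.1 (p.2 j) ≤ t} :=
      measurableSet_le (measurable_sinSq measurable_fst (hm j)) measurable_const
    rw [userLaw, Measure.prod_apply hms]
    calc _ ≤ ∫⁻ _, ENNReal.ofReal a ∂(channelLaw M) := by
          refine lintegral_mono_ae ?_
          filter_upwards [ae_channelLaw_ne_zero hM] with h hh
          refine le_trans (le_of_eq ?_) (hcap h hh)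
          exact (measurePreserving_eval (fun _ : Fin (2 ^ B) => μ) j).measure_preimage
            (measurableSet_le (measurable_sinSq measurable_const measurable_id)
              measurable_const).nullMeasurableSet
      _ = _ := by simp
  calc _ ≤ userLaw μ B (⋃ j, {p | sinSq p.1 (p.2 j) ≤ t}) :=
        measure_mono fun p hp => by
          rw [Set.mem_iUnion]
          rw [Set.mem_ofPred_eq, quantize] at hp
          exact ⟨feedbackIndex p.1 p.2, hp⟩
    _ ≤ ∑ j, userLaw μ B {p | sinSq p.1 (p.2 j) ≤ t} := measure_iUnion_fintype_le _ _
    _ ≤ ∑ _j : Fin (2 ^ B), ENNReal.ofReal a := Finset.sum_le_sum fun j _ => hj j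
    _ = _ := by
        rw [Finset.sum_const, Finset.card_univ, Fintype.card_fin, nsmul_eq_mul,
          ENNReal.ofReal_mul (by positivity), ENNReal.ofReal_pow (by norm_num), Nat.cast_pow,
          Nat.cast_ofNat, ENNReal.ofReal_ofNat]

/-- All 2^B independent words must miss the cap, and (1 - a)^(2^B) ≤ exp(-2^B a) in effect. -/
theorem IsIsotropic.measure_lt_sinSq_quantize {μ : Measure (CVec M)} (hμ : IsIsotropic μ)
    (hM : 0 < M) (B : ℕ) {t a : ℝ}
    (hcap : ∀ h : CVec M, h ≠ 0 → ENNReal.ofReal a ≤ μ {w | sinSq h w ≤ t}) :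
    userLaw μ B {p | t < sinSq p.1 (quantize p.1 p.2)} ≤
      ENNReal.ofReal (Real.exp (-(2 ^ B * a))) := by
  have := hμ.isProbabilityMeasure
  have hms : MeasurableSet {p : CVec M × Codebook M B | t < sinSq p.1 (quantize p.1 p.2)} :=
    measurableSet_lt measurable_const (measurable_sinSq measurable_fst measurable_quantize)
  have h1 : ∀ h : CVec M, h ≠ 0 → μ {w | t < sinSq h w} ≤ ENNReal.ofReal (Real.exp (-a)) := by
    intro h hh
    have hc : {w : CVec M | t < sinSq h w} = {w | sinSq h w ≤ t}ᶜ := by ext; simp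
    have hcm : MeasurableSet {w : CVec M | sinSq h w ≤ t} :=
      measurableSet_le (measurable_sinSq measurable_const measurable_id) measurable_const
    rw [hc, prob_compl_eq_one_sub hcm]
    calc 1 - μ {w | sinSq h w ≤ t} ≤ 1 - ENNReal.ofReal a := tsub_le_tsub_left (hcap h hh) _
      _ ≤ ENNReal.ofReal (1 - a) := by
          rw [tsub_le_iff_right, ← ENNReal.ofReal_one]
          refine le_trans (ENNReal.ofReal_le_ofReal (by linarith)) ENNReal.ofReal_add_le
      _ ≤ _ := ENNReal.ofReal_le_ofReal (by linarith [Real.add_one_le_exp (-a)])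
  rw [userLaw, Measure.prod_apply hms]
  calc _ ≤ ∫⁻ _, ENNReal.ofReal (Real.exp (-(2 ^ B * a))) ∂(channelLaw M) := by
        refine lintegral_mono_ae ?_
        filter_upwards [ae_channelLaw_ne_zero hM] with h hh
        calc _ ≤ (Measure.pi fun _ : Fin (2 ^ B) => μ)
              (Set.univ.pi fun _ => {w : CVec M | t < sinSq h w}) := by
              -- Codewords have unit norm almost surely, so maximizing the inner product minimizes
              -- `sinSq`.
              refine measure_mono_ae ?_
              filter_upwards [hμ.ae_codebook_norm (B := B)] with w hw hlt j _
              have hlt' : t < sinSq h (quantize h w) := hlt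
              refine hlt'.trans_le ?_
              have hq : ‖quantize h w‖ = 1 := hw _
              rw [sinSq, sinSq, hq, hw j]
              have := norm_inner_le_quantize h w j
              gcongr
          _ = μ {w | t < sinSq h w} ^ (2 ^ B) := by
              rw [Measure.pi_pi, Finset.prod_const, Finset.card_univ, Fintype.card_fin]
          _ ≤ ENNReal.ofReal (Real.exp (-a)) ^ (2 ^ B) := by
              gcongr
              exact h1 h hh
          _ = _ := by
              rw [← ENNReal.ofReal_pow (Real.exp_pos _).le, ← Real.exp_nat_mul]
              congr 2
              push_cast
              ring
    _ = _ := by simp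

end QuantizationError

/-! ### Measurability of beams, SINR and rate. -/

section Measurability

variable {M : ℕ}

theorem measurable_inverseColumn (j : Fin M) :
    Measurable fun g : Fin M → CVec M => inverseColumn g j := by
  have hc : Continuous fun g : Fin M → CVec M => channelMatrix g := by
    refine continuous_matrix fun i k => ?_
    simp only [channelMatrix, Matrix.of_apply]
    fun_prop
  have h1 : Measurable fun (g : Fin M → CVec M) k => (channelMatrix g)⁻¹ k j := by
    refine measurable_pi_iff.2 fun k => ?_
    -- Adjugate over determinant: measurable everywhere, with inverse 0 at singular matrices.
    simp only [Matrix.inv_def, Ring.inverse_eq_inv', Matrix.smul_apply, smul_eq_mul]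
    have h2 : Continuous fun g : Fin M → CVec M => (channelMatrix g).det := hc.matrix_det
    have h3 : Continuous fun g : Fin M → CVec M => (channelMatrix g).adjugate k j :=
      hc.matrix_adjugate.matrix_elem k j
    exact h2.measurable.inv.mul h3.measurable
  unfold inverseColumn
  exact (WithLp.measurable_toLp 2 (Fin M → ℂ)).comp h1

theorem measurable_inverseEnergy : Measurable (inverseEnergy (M := M)) := by
  unfold inverseEnergy
  exact Finset.measurable_fun_sum _ fun j _ => (measurable_inverseColumn j).norm.pow_const 2

theorem measurable_zeroForcing (j : Fin M) :
    Measurable fun g : Fin M → CVec M => zeroForcing g j := by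
  have h := measurable_inverseColumn j
  unfold zeroForcing
  fun_prop

theorem measurable_feedbackSinr {B : ℕ} (P : ℝ) (i : Fin M) :
    Measurable fun x : (Fin M → CVec M) × (Fin M → Codebook M B) =>
      feedbackSinr P x.1 x.2 i := by
  have hq : Measurable fun (x : (Fin M → CVec M) × (Fin M → Codebook M B)) j =>
      quantize (x.1 j) (x.2 j) := by
    refine measurable_pi_iff.2 fun j => ?_
    have h1 : Measurable fun x : (Fin M → CVec M) × (Fin M → Codebook M B) => (x.1 j, x.2 j) :=
      ((measurable_pi_apply j).comp measurable_fst).prodMk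
        ((measurable_pi_apply j).comp measurable_snd)
    exact measurable_quantize.comp h1
  have hin : ∀ j, Measurable fun x : (Fin M → CVec M) × (Fin M → Codebook M B) =>
      ‖inner ℂ (x.1 i) (zeroForcing (fun l => quantize (x.1 l) (x.2 l)) j)‖ ^ 2 := fun j => by
    have h1 : Measurable fun x : (Fin M → CVec M) × (Fin M → Codebook M B) => x.1 i :=
      (measurable_pi_apply i).comp measurable_fst
    have h2 := (measurable_zeroForcing j).comp hq
    exact (Measurable.inner (𝕜 := ℂ) h1 h2).norm.pow_const 2
  unfold feedbackSinr sinr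
  exact ((hin i).const_mul _).div (measurable_const.add
    (Finset.measurable_fun_sum _ fun j _ => (hin j).const_mul _))

theorem measurable_instantRate {B : ℕ} (P : ℝ) (i : Fin M) :
    Measurable (instantRate (B := B) P i) := by
  have h := measurable_feedbackSinr (B := B) P i
  unfold instantRate Real.logb
  exact (Real.measurable_log.comp (measurable_const.add h)).div_const _

end Measurability

/-! ### Second moment of the channel. -/

section Moments

variable {M : ℕ}

theorem integrable_sq_gaussianReal_half :
    Integrable (fun x : ℝ => x ^ 2) (gaussianReal 0 (1 / 2)) :=
  (memLp_id_gaussianReal 2).integrable_sq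

theorem integrable_norm_sq_complexGaussian :
    Integrable (fun z : ℂ => ‖z‖ ^ 2) complexGaussian := by
  rw [complexGaussian, integrable_map_measure (by fun_prop) measurable_complex_mk.aemeasurable]
  have h1 : ((fun z : ℂ => ‖z‖ ^ 2) ∘ fun p : ℝ × ℝ => (⟨p.1, p.2⟩ : ℂ)) =
      fun p => p.1 ^ 2 + p.2 ^ 2 := by
    ext1 p
    simp only [Function.comp]
    rw [← Complex.normSq_eq_norm_sq, Complex.normSq_apply]
    ring
  rw [h1]
  exact (integrable_sq_gaussianReal_half.comp_fst _).add
    (integrable_sq_gaussianReal_half.comp_snd _)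

theorem integrable_norm_sq_channelLaw :
    Integrable (fun x : CVec M => ‖x‖ ^ 2) (channelLaw M) := by
  rw [channelLaw, integrable_map_measure (by fun_prop) (by fun_prop)]
  have h1 : ((fun x : CVec M => ‖x‖ ^ 2) ∘ WithLp.toLp 2) =
      fun x : Fin M → ℂ => ∑ k, ‖x k‖ ^ 2 := by
    ext1 x
    simp [EuclideanSpace.norm_sq_eq]
  rw [h1]
  exact integrable_finsetSum _ fun k _ =>
    (measurePreserving_eval (fun _ : Fin M => complexGaussian) k).integrable_comp_of_integrable
      integrable_norm_sq_complexGaussian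

end Moments

/-! ### From SINR probabilities to average rates. -/

section RateBounds

variable {M B : ℕ}

theorem sinr_nonneg {P : ℝ} (hP : 0 ≤ P) (h v : Fin M → CVec M) (i : Fin M) :
    0 ≤ sinr P h v i := by
  unfold sinr
  have : 0 ≤ ∑ j ∈ Finset.univ.erase i, P / M * ‖inner ℂ (h i) (v j)‖ ^ 2 :=
    Finset.sum_nonneg fun _ _ => by positivity
  positivity

theorem sinr_le_mul_norm_sq {P : ℝ} (hP : 0 ≤ P) (h v : Fin M → CVec M) (i : Fin M)
    (hv : ‖v i‖ ≤ 1) : sinr P h v i ≤ P * ‖h i‖ ^ 2 := by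
  unfold sinr
  have hM : (1 : ℝ) ≤ M := by exact_mod_cast Fin.pos i
  have h1 : 0 ≤ ∑ j ∈ Finset.univ.erase i, P / M * ‖inner ℂ (h i) (v j)‖ ^ 2 :=
    Finset.sum_nonneg fun _ _ => by positivity
  have h2 : ‖inner ℂ (h i) (v i)‖ ≤ ‖h i‖ :=
    (norm_inner_le_norm _ _).trans (mul_le_of_le_one_right (norm_nonneg _) hv)
  refine (div_le_self (by positivity) (by linarith)).trans ?_
  gcongr
  exact div_le_self hP hM

theorem instantRate_nonneg {P : ℝ} (hP : 0 ≤ P) (i : Fin M)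
    (x : (Fin M → CVec M) × (Fin M → Codebook M B)) : 0 ≤ instantRate P i x :=
  Real.logb_nonneg one_lt_two (by
    have : 0 ≤ feedbackSinr P x.1 x.2 i := sinr_nonneg hP _ _ _
    linarith)

theorem logb_one_add_le {y : ℝ} (hy : 0 ≤ y) : Real.logb 2 (1 + y) ≤ y / Real.log 2 := by
  have h2 : 0 < Real.log 2 := Real.log_pos one_lt_two
  unfold Real.logb
  gcongr
  have := Real.log_le_sub_one_of_pos (by linarith : 0 < 1 + y)
  linarith

theorem instantRate_le {P : ℝ} (hP : 0 ≤ P) (i : Fin M)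
    (x : (Fin M → CVec M) × (Fin M → Codebook M B)) :
    instantRate P i x ≤ Real.logb 2 (1 + P * ‖x.1 i‖ ^ 2) := by
  have h0 : 0 ≤ feedbackSinr P x.1 x.2 i := sinr_nonneg hP _ _ _
  have h1 : feedbackSinr P x.1 x.2 i ≤ P * ‖x.1 i‖ ^ 2 :=
    sinr_le_mul_norm_sq hP _ _ _ (norm_zeroForcing_le _ _)
  exact Real.logb_le_logb_of_le one_lt_two (by linarith) (by linarith)

theorem integrable_channel_norm_sq (μ : Measure (CVec M)) [IsProbabilityMeasure μ] (B : ℕ)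
    (i : Fin M) : Integrable (fun x => ‖x.1 i‖ ^ 2) (systemLaw μ B) :=
  (systemLaw_measurePreserving_channel μ B i).integrable_comp_of_integrable
    integrable_norm_sq_channelLaw

theorem integral_channel_norm_sq (μ : Measure (CVec M)) [IsProbabilityMeasure μ] (B : ℕ)
    (i : Fin M) : ∫ x, ‖x.1 i‖ ^ 2 ∂(systemLaw μ B) = ∫ h, ‖h‖ ^ 2 ∂(channelLaw M) := by
  rw [← (systemLaw_measurePreserving_channel μ B i).map_eq, integral_map]
  · exact (systemLaw_measurePreserving_channel μ B i).measurable.aemeasurable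
  · fun_prop

theorem integrable_instantRate (μ : Measure (CVec M)) [IsProbabilityMeasure μ] {P : ℝ}
    (hP : 0 ≤ P) (i : Fin M) : Integrable (instantRate P i) (systemLaw μ B) := by
  refine (((integrable_channel_norm_sq μ B i).const_mul P).div_const (Real.log 2)).mono'
    (measurable_instantRate P i).aestronglyMeasurable (ae_of_all _ fun x => ?_)
  rw [Real.norm_of_nonneg (instantRate_nonneg hP i x)]
  exact (instantRate_le hP i x).trans (logb_one_add_le (by positivity))

/-- Above the threshold T, discard interference and split log(1 + P‖h‖²) ≤ log P + log(1 + ‖h‖²).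
The second piece is integrated over the whole space, so the probability of the event multiplies only
log P and no independence is required. -/
theorem userRate_le (μ : Measure (CVec M)) [IsProbabilityMeasure μ] {P T : ℝ} (hP : 1 ≤ P)
    (hT : 0 ≤ T) (i : Fin M) :
    userRate μ B P i ≤ Real.logb 2 (1 + T) +
      (systemLaw μ B).real {x | T < feedbackSinr P x.1 x.2 i} * Real.logb 2 P +
      (∫ h, ‖h‖ ^ 2 ∂(channelLaw M)) / Real.log 2 := by
  have hl2 : 0 < Real.log 2 := Real.log_pos one_lt_two
  set E := {x : (Fin M → CVec M) × (Fin M → Codebook M B) | T < feedbackSinr P x.1 x.2 i} with hE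
  have hEm : MeasurableSet E := measurableSet_lt measurable_const (measurable_feedbackSinr P i)
  have hLP : 0 ≤ Real.logb 2 P := Real.logb_nonneg one_lt_two hP
  have hLT : 0 ≤ Real.logb 2 (1 + T) := Real.logb_nonneg one_lt_two (by linarith)
  have hint := integrable_channel_norm_sq μ B i
  have hintE : Integrable (E.indicator fun _ => Real.logb 2 P) (systemLaw μ B) :=
    (integrable_const _).indicator hEm
  calc userRate μ B P i ≤ ∫ x, (Real.logb 2 (1 + T) + E.indicator (fun _ => Real.logb 2 P) x +
        ‖x.1 i‖ ^ 2 / Real.log 2) ∂(systemLaw μ B) := by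
        refine integral_mono (integrable_instantRate μ (by linarith) i)
          (((integrable_const _).add hintE).add (hint.div_const _)) fun x => ?_
        have hx0 : 0 ≤ ‖x.1 i‖ ^ 2 / Real.log 2 := by positivity
        by_cases hx : x ∈ E
        · simp only [Set.indicator_of_mem hx]
          have h1 := instantRate_le (by linarith : 0 ≤ P) i x
          have h2 : Real.logb 2 (1 + P * ‖x.1 i‖ ^ 2) ≤
              Real.logb 2 P + Real.logb 2 (1 + ‖x.1 i‖ ^ 2) := by
            rw [← Real.logb_mul (by positivity) (by positivity)]
            exact Real.logb_le_logb_of_le one_lt_two (by positivity) (by linarith)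
          have h3 := logb_one_add_le (sq_nonneg ‖x.1 i‖)
          linarith
        · simp only [Set.indicator_of_notMem hx, add_zero]
          have h1 : feedbackSinr P x.1 x.2 i ≤ T := not_lt.1 hx
          have h0 : 0 ≤ feedbackSinr P x.1 x.2 i := sinr_nonneg (by linarith) _ _ _
          have h2 : instantRate P i x ≤ Real.logb 2 (1 + T) :=
            Real.logb_le_logb_of_le one_lt_two (by linarith) (by linarith)
          linarith
    _ = _ := by
        have hsum : Integrable (fun x => Real.logb 2 (1 + T) +
            E.indicator (fun _ => Real.logb 2 P) x) (systemLaw μ B) :=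
          (integrable_const _).add hintE
        rw [integral_add hsum (hint.div_const _),
          integral_add (integrable_const _) hintE, integral_div, integral_channel_norm_sq,
          integral_indicator_const _ hEm]
        simp

theorem le_userRate (μ : Measure (CVec M)) [IsProbabilityMeasure μ] {P T : ℝ} (hP : 0 ≤ P)
    (hT : 1 ≤ T) (i : Fin M) :
    (1 - (systemLaw μ B).real {x | feedbackSinr P x.1 x.2 i < T}) * Real.logb 2 T ≤
      userRate μ B P i := by
  set E := {x : (Fin M → CVec M) × (Fin M → Codebook M B) | feedbackSinr P x.1 x.2 i < T}
  have hEm : MeasurableSet E := measurableSet_lt (measurable_feedbackSinr P i) measurable_const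
  have hLT : 0 ≤ Real.logb 2 T := Real.logb_nonneg one_lt_two hT
  calc (1 - (systemLaw μ B).real E) * Real.logb 2 T
      = ∫ x, Eᶜ.indicator (fun _ => Real.logb 2 T) x ∂(systemLaw μ B) := by
        rw [integral_indicator_const _ hEm.compl, probReal_compl_eq_one_sub hEm, smul_eq_mul]
    _ ≤ userRate μ B P i := by
        refine integral_mono ((integrable_const _).indicator hEm.compl)
          (integrable_instantRate μ hP i) fun x => ?_
        by_cases hx : x ∈ E
        · rw [Set.indicator_of_notMem (by simpa using hx)]
          exact instantRate_nonneg hP i x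
        · rw [Set.indicator_of_mem (by simpa using hx)]
          have h1 : T ≤ feedbackSinr P x.1 x.2 i := not_lt.1 hx
          exact Real.logb_le_logb_of_le one_lt_two (by linarith) (by linarith)

end RateBounds

/-! ### Probabilities of unusually large or small SINR. -/

section Outage

variable {M B : ℕ}

theorem IsIsotropic.ae_quantize_regular {μ : Measure (CVec M)} (hμ : IsIsotropic μ)
    (hM : 0 < M) (B : ℕ) :
    ∀ᵐ x ∂(systemLaw μ B), LinearIndependent ℂ (fun j => quantize (x.1 j) (x.2 j)) ∧
      (∀ j, ‖quantize (x.1 j) (x.2 j)‖ = 1) ∧ ∀ j, x.1 j ≠ 0 := by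
  have := hμ.isProbabilityMeasure
  have h1 := (hμ.measurePreserving_quantize B).quasiMeasurePreserving.ae
    (hμ.ae_linearIndependent hM M le_rfl)
  have h2 := (hμ.measurePreserving_quantize B).quasiMeasurePreserving.ae
    (p := fun g => ∀ j, ‖g j‖ = 1) (ae_all_iff.2 fun j =>
      (Measure.quasiMeasurePreserving_eval (fun _ : Fin M => μ) j).ae hμ.norm_eq_one)
  have h3 : ∀ᵐ x ∂(systemLaw μ B), ∀ j, x.1 j ≠ 0 := ae_all_iff.2 fun j =>
    (systemLaw_measurePreserving_channel μ B j).quasiMeasurePreserving.ae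
      (ae_channelLaw_ne_zero hM)
  filter_upwards [h1, h2, h3] with x a b c using ⟨a, b, c⟩

/-- The right side is free of B, which makes the tail uniform in P. -/
theorem IsIsotropic.measure_inverseEnergy {μ : Measure (CVec M)} (hμ : IsIsotropic μ) (B : ℕ)
    (k : ℝ) :
    systemLaw μ B {x | k < inverseEnergy fun j => quantize (x.1 j) (x.2 j)} =
      (Measure.pi fun _ : Fin M => μ) {g | k < inverseEnergy g} :=
  (hμ.measurePreserving_quantize B).measure_preimage
    (measurableSet_lt measurable_const measurable_inverseEnergy).nullMeasurableSet

theorem IsIsotropic.measureReal_sinr_gt {μ : Measure (CVec M)} (hμ : IsIsotropic μ)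
    {P t k a : ℝ} (hP : 0 < P) (ht : 0 < t) (ha : 0 ≤ a)
    (hcap : ∀ h : CVec M, h ≠ 0 → μ {w | sinSq h w ≤ t} ≤ ENNReal.ofReal a) (i : Fin M) :
    (systemLaw μ B).real {x | k / t < feedbackSinr P x.1 x.2 i} ≤
      (Measure.pi fun _ : Fin M => μ).real {g | k < inverseEnergy g} + 2 ^ B * a := by
  have := hμ.isProbabilityMeasure
  have hM := Fin.pos i
  have h1 : systemLaw μ B {x | k / t < feedbackSinr P x.1 x.2 i} ≤
      (Measure.pi fun _ : Fin M => μ) {g | k < inverseEnergy g} + ENNReal.ofReal (2 ^ B * a) := by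
    calc _ ≤ systemLaw μ B ({x | k < inverseEnergy fun j => quantize (x.1 j) (x.2 j)} ∪
          {x | sinSq (x.1 i) (quantize (x.1 i) (x.2 i)) ≤ t}) := by
          refine measure_mono_ae ?_
          filter_upwards [hμ.ae_quantize_regular hM B] with x ⟨hx1, hx2, hx3⟩ hx
          by_contra hcon
          obtain ⟨hc1, hc2⟩ := not_or.1 hcon
          have hc1' : inverseEnergy (fun j => quantize (x.1 j) (x.2 j)) ≤ k := not_lt.1 hc1
          have hc2' : t ≤ sinSq (x.1 i) (quantize (x.1 i) (x.2 i)) := (not_le.1 hc2).le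
          have hx' : k / t < sinr P x.1 (zeroForcing fun j => quantize (x.1 j) (x.2 j)) i := hx
          have := sinr_zeroForcing_le hx1 hx2 (hx3 i) hP ht hc2'
          have h5 : inverseEnergy (fun j => quantize (x.1 j) (x.2 j)) / t ≤ k / t := by gcongr
          linarith
      _ ≤ _ := by
          refine (measure_union_le _ _).trans (add_le_add (hμ.measure_inverseEnergy B k).le ?_)
          refine le_trans (le_of_eq ?_) (hμ.measure_sinSq_quantize_le hM B hcap)
          exact (systemLaw_measurePreserving_user μ B i).measure_preimage
            (measurableSet_le (measurable_sinSq measurable_fst measurable_quantize)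
              measurable_const).nullMeasurableSet
  have h2 := ENNReal.toReal_mono (by finiteness) h1
  rwa [ENNReal.toReal_add (by finiteness) (by finiteness),
    ENNReal.toReal_ofReal (by positivity)] at h2

/-- The three terms are the ways the deterministic lower bound can fail: ill-conditioned beams, a
weak channel, a codebook missing the cap. -/
theorem IsIsotropic.measureReal_sinr_lt {μ : Measure (CVec M)} (hμ : IsIsotropic μ)
    {P t k a : ℝ} (hP : 0 < P) (ht : 0 < t) (hPt : 1 ≤ P * t) (hk : 1 ≤ k)
    (htk : 16 * (k * t) ≤ 1)
    (hcap : ∀ h : CVec M, h ≠ 0 → ENNReal.ofReal a ≤ μ {w | sinSq h w ≤ t}) (i : Fin M) :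
    (systemLaw μ B).real {x | feedbackSinr P x.1 x.2 i < 1 / (8 * M * k ^ 2 * t)} ≤
      (Measure.pi fun _ : Fin M => μ).real {g | k < inverseEnergy g} +
        (channelLaw M).real {h | k < (‖h‖ ^ 2)⁻¹} + Real.exp (-(2 ^ B * a)) := by
  have := hμ.isProbabilityMeasure
  have hM := Fin.pos i
  have h1 : systemLaw μ B {x | feedbackSinr P x.1 x.2 i < 1 / (8 * M * k ^ 2 * t)} ≤
      (Measure.pi fun _ : Fin M => μ) {g | k < inverseEnergy g} +
        channelLaw M {h | k < (‖h‖ ^ 2)⁻¹} + ENNReal.ofReal (Real.exp (-(2 ^ B * a))) := by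
    calc _ ≤ systemLaw μ B ({x | k < inverseEnergy fun j => quantize (x.1 j) (x.2 j)} ∪
          {x | k < (‖x.1 i‖ ^ 2)⁻¹} ∪
          {x | t < sinSq (x.1 i) (quantize (x.1 i) (x.2 i))}) := by
          refine measure_mono_ae ?_
          filter_upwards [hμ.ae_quantize_regular hM B] with x ⟨hx1, hx2, hx3⟩ hx
          by_contra hcon
          obtain ⟨hc12, hc3⟩ := not_or.1 hcon
          obtain ⟨hc1, hc2⟩ := not_or.1 hc12
          have hc1' : inverseEnergy (fun j => quantize (x.1 j) (x.2 j)) ≤ k := not_lt.1 hc1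
          have hc2' : (‖x.1 i‖ ^ 2)⁻¹ ≤ k := not_lt.1 hc2
          have hc3' : sinSq (x.1 i) (quantize (x.1 i) (x.2 i)) ≤ t := not_lt.1 hc3
          have hpos : 0 < ‖x.1 i‖ ^ 2 := by
            have := hx3 i
            positivity
          have hx' : sinr P x.1 (zeroForcing fun j => quantize (x.1 j) (x.2 j)) i <
            1 / (8 * M * k ^ 2 * t) := hx
          have := le_sinr_zeroForcing hx1 hx2 hP ht hPt hc3' hk hc1'
            ((inv_le_iff_one_le_mul₀ hpos).1 hc2') htk
          linarith
      _ ≤ _ := by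
          refine (measure_union_le _ _).trans (add_le_add ((measure_union_le _ _).trans
            (add_le_add (hμ.measure_inverseEnergy B k).le ?_)) ?_)
          · exact ((systemLaw_measurePreserving_channel μ B i).measure_preimage
              (measurableSet_lt measurable_const (by fun_prop)).nullMeasurableSet).le
          · refine le_trans (le_of_eq ?_) (hμ.measure_lt_sinSq_quantize hM B hcap)
            exact (systemLaw_measurePreserving_user μ B i).measure_preimage
              (measurableSet_lt measurable_const
                (measurable_sinSq measurable_fst measurable_quantize)).nullMeasurableSet
  have h2 := ENNReal.toReal_mono (by finiteness) h1
  rwa [ENNReal.toReal_add (by finiteness) (by finiteness),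
    ENNReal.toReal_add (by finiteness) (by finiteness),
    ENNReal.toReal_ofReal (by positivity)] at h2

end Outage

/-! ### Choice of power-law scales and passage to the limit. -/

section Asymptotics

theorem tendsto_measureReal_lt_atTop {X : Type*} [MeasurableSpace X] (ν : Measure X)
    [IsFiniteMeasure ν] {f : X → ℝ} (hf : Measurable f) :
    Tendsto (fun k : ℝ => ν.real {x | k < f x}) atTop (𝓝 0) := by
  have h := tendsto_measure_iInter_atTop (μ := ν) (s := fun k : ℝ => {x | k < f x})
    (fun k => (measurableSet_lt measurable_const hf).nullMeasurableSet)
    (fun a b hab x hx => lt_of_le_of_lt hab hx) ⟨0, measure_ne_top _ _⟩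
  have h0 : ⋂ k : ℝ, {x | k < f x} = ∅ := by
    ext x
    simp only [Set.mem_iInter, Set.mem_empty_iff_false, iff_false, not_forall]
    exact ⟨f x, fun hx => lt_irrefl (f x) hx⟩
  rw [h0, measure_empty] at h
  have h1 := (ENNReal.tendsto_toReal ENNReal.zero_ne_top).comp h
  rw [ENNReal.toReal_zero] at h1
  exact h1

theorem tendsto_logb_two : Tendsto (Real.logb 2) atTop atTop :=
  Real.tendsto_logb_atTop one_lt_two

theorem two_rpow_eq_exp (x : ℝ) : (2 : ℝ) ^ x = Real.exp (Real.log 2 * x) :=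
  Real.rpow_def_of_pos two_pos x

theorem tendsto_two_rpow_atTop {ι : Type*} {l : Filter ι} {f : ι → ℝ} (hf : Tendsto f l atTop) :
    Tendsto (fun x => (2 : ℝ) ^ f x) l atTop := by
  simp only [two_rpow_eq_exp]
  exact Real.tendsto_exp_atTop.comp (hf.const_mul_atTop (Real.log_pos one_lt_two))

theorem tendsto_two_rpow_atBot {ι : Type*} {l : Filter ι} {f : ι → ℝ} (hf : Tendsto f l atBot) :
    Tendsto (fun x => (2 : ℝ) ^ f x) l (𝓝 0) := by
  simp only [two_rpow_eq_exp]
  exact Real.tendsto_exp_atBot.comp (hf.const_mul_atBot (Real.log_pos one_lt_two))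

variable {α : ℝ} {B : ℝ → ℕ}

/-- For t = P^(-τ) and m = M-1, the load 2^B t^m is, up to constants, the expected number of
codewords in a cap of squared radius t. The exponent shows that it tends to 0 or ∞ according to the
sign of α - τ m. -/
theorem eventually_load_eq (m : ℕ) (τ : ℝ) :
    (fun P : ℝ => (2 : ℝ) ^ (Real.logb 2 P * ((B P : ℝ) / Real.logb 2 P - τ * m))) =ᶠ[atTop]
      fun P => 2 ^ B P * ((2 : ℝ) ^ (-τ * Real.logb 2 P)) ^ m := by
  filter_upwards [tendsto_logb_two.eventually_gt_atTop 0] with P hL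
  rw [← Real.rpow_natCast 2 (B P), ← Real.rpow_natCast _ m, ← Real.rpow_mul two_pos.le,
    ← Real.rpow_add two_pos]
  congr 1
  field_simp
  ring

theorem tendsto_load_zero (hB : Tendsto (fun P : ℝ => (B P : ℝ) / Real.logb 2 P) atTop (𝓝 α))
    (m : ℕ) {τ : ℝ} (hτ : α < τ * m) :
    Tendsto (fun P => 2 ^ B P * ((2 : ℝ) ^ (-τ * Real.logb 2 P)) ^ m) atTop (𝓝 0) :=
  (tendsto_two_rpow_atBot (tendsto_logb_two.atTop_mul_neg (sub_neg.2 hτ)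
    (hB.sub_const _))).congr' (eventually_load_eq m τ)

theorem tendsto_load_atTop (hB : Tendsto (fun P : ℝ => (B P : ℝ) / Real.logb 2 P) atTop (𝓝 α))
    (m : ℕ) {τ : ℝ} (hτ : τ * m < α) :
    Tendsto (fun P => 2 ^ B P * ((2 : ℝ) ^ (-τ * Real.logb 2 P)) ^ m) atTop atTop :=
  (tendsto_two_rpow_atTop (tendsto_logb_two.atTop_mul_pos (sub_pos.2 hτ)
    (hB.sub_const _))).congr' (eventually_load_eq m τ)

variable {M : ℕ} {μ : Measure (CVec M)}

/-- With b = α/(M-1), take t = P^(-(b+η)), just below the typical error, and k = P^η. The threshold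
k/t is P^(b+2η), and the third η absorbs vanishing terms. -/
theorem IsIsotropic.eventually_userRate_div_lt (hμ : IsIsotropic μ) (hM : 2 ≤ M)
    (hB : Tendsto (fun P : ℝ => (B P : ℝ) / Real.logb 2 P) atTop (𝓝 α)) (hα : 0 ≤ α)
    {η : ℝ} (hη : 0 < η) (i : Fin M) :
    ∀ᶠ P in atTop, userRate μ (B P) P i / Real.logb 2 P < α / (M - 1 : ℕ) + 3 * η := by
  have := hμ.isProbabilityMeasure
  have hm : (0 : ℝ) < (M - 1 : ℕ) := by exact_mod_cast (by omega : 0 < M - 1)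
  obtain ⟨c, C, hc, hC, hcap⟩ := hμ.exists_cap_bounds (by omega)
  set b := α / (M - 1 : ℕ) with hb
  have hb0 : 0 ≤ b := by positivity
  have hload := tendsto_load_zero hB (M - 1) (τ := b + η) (by
    rw [add_mul, hb, div_mul_cancel₀ _ hm.ne']
    nlinarith)
  have htail := (tendsto_measureReal_lt_atTop (Measure.pi fun _ : Fin M => μ)
    measurable_inverseEnergy).comp (tendsto_two_rpow_atTop (tendsto_logb_two.const_mul_atTop hη))
  set D := 1 + (∫ h, ‖h‖ ^ 2 ∂(channelLaw M)) / Real.log 2 with hD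
  have hlim : Tendsto (fun P : ℝ => D / Real.logb 2 P + (b + 2 * η) +
      ((Measure.pi fun _ : Fin M => μ).real {g | (2 : ℝ) ^ (η * Real.logb 2 P) < inverseEnergy g} +
      C * (2 ^ B P * ((2 : ℝ) ^ (-(b + η) * Real.logb 2 P)) ^ (M - 1)))) atTop
      (𝓝 (0 + (b + 2 * η) + (0 + C * 0))) :=
    ((tendsto_logb_two.const_div_atTop D).add_const _).add (htail.add (hload.const_mul C))
  filter_upwards [hlim.eventually_lt_const
      (by linarith : 0 + (b + 2 * η) + (0 + C * 0) < b + 3 * η),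
    tendsto_logb_two.eventually_gt_atTop 0, eventually_ge_atTop 1] with P hP hL hP1
  refine lt_of_le_of_lt ?_ hP
  set L := Real.logb 2 P with hLdef
  set t := (2 : ℝ) ^ (-(b + η) * L) with ht
  set k := (2 : ℝ) ^ (η * L) with hk
  have ht0 : 0 < t := by positivity
  have ht1 : t ≤ 1 := Real.rpow_le_one_of_one_le_of_nonpos one_le_two (by nlinarith)
  have hQ := hμ.measureReal_sinr_gt (B := B P) (k := k) (by linarith : 0 < P) ht0
    (by positivity : 0 ≤ C * t ^ (M - 1)) (fun h hh => (hcap h hh t ht0.le ht1).2) i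
  have hR := userRate_le μ (B := B P) hP1 (by positivity : 0 ≤ k / t) i
  have hT : k / t = 2 ^ ((b + 2 * η) * L) := by
    rw [hk, ht, ← Real.rpow_sub two_pos]
    congr 1
    ring
  have hlog : Real.logb 2 (1 + k / t) ≤ 1 + (b + 2 * η) * L := by
    have h1 : 1 ≤ k / t := by
      rw [hT]; exact Real.one_le_rpow one_le_two (by positivity)
    calc Real.logb 2 (1 + k / t) ≤ Real.logb 2 (2 * (k / t)) :=
          Real.logb_le_logb_of_le one_lt_two (by positivity) (by linarith)
      _ = _ := by
          rw [Real.logb_mul (by norm_num) (by positivity), hT, Real.logb_rpow two_pos (by norm_num),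
            Real.logb_self_eq_one one_lt_two]
  rw [div_le_iff₀ hL, add_mul, add_mul, div_mul_cancel₀ _ hL.ne']
  have hQ' := mul_le_mul_of_nonneg_right hQ hL.le
  rw [mul_left_comm (2 ^ B P) C] at hQ'
  rw [hD]
  linarith

/-- Take t = P^(-(b-η)), just above the typical error, and k = P^(η/2), so that k² t = P^(-(b-2η))
and the threshold is P^(b-2η)/(8M). -/
theorem IsIsotropic.eventually_lt_userRate_div (hμ : IsIsotropic μ) (hM : 2 ≤ M)
    (hB : Tendsto (fun P : ℝ => (B P : ℝ) / Real.logb 2 P) atTop (𝓝 α))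
    (hα1 : α < (M - 1 : ℕ)) {η : ℝ} (hη : 0 < η) (i : Fin M) :
    ∀ᶠ P in atTop, α / (M - 1 : ℕ) - 3 * η < userRate μ (B P) P i / Real.logb 2 P := by
  have := hμ.isProbabilityMeasure
  have hm : (0 : ℝ) < (M - 1 : ℕ) := by exact_mod_cast (by omega : 0 < M - 1)
  have hM0 : (0 : ℝ) < M := by exact_mod_cast (by omega : 0 < M)
  obtain ⟨c, C, hc, hC, hcap⟩ := hμ.exists_cap_bounds (by omega)
  set b := α / (M - 1 : ℕ) with hb
  have hb1 : b < 1 := (div_lt_one hm).2 hα1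
  -- If b ≤ 2η the claimed bound is negative and the rate is not; otherwise t and k t tend to 0.
  rcases le_or_gt b (2 * η) with hbη | hbη
  · filter_upwards [eventually_ge_atTop 1] with P hP
    have h1 : 0 ≤ userRate μ (B P) P i :=
      integral_nonneg fun x => instantRate_nonneg (by linarith) i x
    have h2 : 0 ≤ Real.logb 2 P := Real.logb_nonneg one_lt_two hP
    have h3 : 0 ≤ userRate μ (B P) P i / Real.logb 2 P := by positivity
    linarith
  have hload := tendsto_load_atTop hB (M - 1) (τ := b - η) (by
    rw [sub_mul, hb, div_mul_cancel₀ _ hm.ne']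
    nlinarith)
  have hk := tendsto_two_rpow_atTop (tendsto_logb_two.const_mul_atTop (half_pos hη))
  have htail := (tendsto_measureReal_lt_atTop (Measure.pi fun _ : Fin M => μ)
    measurable_inverseEnergy).comp hk
  have hchan := (tendsto_measureReal_lt_atTop (channelLaw M) (f := fun h => (‖h‖ ^ 2)⁻¹)
    (by fun_prop)).comp hk
  have hexp : Tendsto (fun P : ℝ => Real.exp
      (-(c * (2 ^ B P * ((2 : ℝ) ^ (-(b - η) * Real.logb 2 P)) ^ (M - 1))))) atTop (𝓝 0) :=
    Real.tendsto_exp_neg_atTop_nhds_zero.comp (hload.const_mul_atTop hc)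
  have hsmall : Tendsto (fun P : ℝ => (2 : ℝ) ^ ((η / 2 - (b - η)) * Real.logb 2 P)) atTop (𝓝 0) :=
    tendsto_two_rpow_atBot (tendsto_logb_two.const_mul_atTop_of_neg (by linarith))
  set D := Real.logb 2 (8 * M) with hD
  have hgain : Tendsto (fun P : ℝ => (b - 2 * η) - D / Real.logb 2 P) atTop
      (𝓝 ((b - 2 * η) - 0)) := (tendsto_logb_two.const_div_atTop D).const_sub _
  have hlim : Tendsto (fun P : ℝ => (1 -
      ((Measure.pi fun _ : Fin M => μ).real
        {g | (2 : ℝ) ^ (η / 2 * Real.logb 2 P) < inverseEnergy g} +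
      (channelLaw M).real {h | (2 : ℝ) ^ (η / 2 * Real.logb 2 P) < (‖h‖ ^ 2)⁻¹} +
      Real.exp (-(c * (2 ^ B P * ((2 : ℝ) ^ (-(b - η) * Real.logb 2 P)) ^ (M - 1)))))) *
      ((b - 2 * η) - D / Real.logb 2 P)) atTop
      (𝓝 ((1 - (0 + 0 + 0)) * ((b - 2 * η) - 0))) :=
    (((htail.add hchan).add hexp).const_sub 1).mul hgain
  filter_upwards [hlim.eventually_const_lt
      (by linarith : b - 3 * η < (1 - (0 + 0 + 0)) * ((b - 2 * η) - 0)),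
    hgain.eventually_const_lt (by linarith : 0 < (b - 2 * η) - 0),
    hsmall.eventually_lt_const (by norm_num : (0 : ℝ) < 1 / 16),
    tendsto_logb_two.eventually_gt_atTop 0, eventually_ge_atTop 1] with P hP hg hs hL hP1
  refine lt_of_lt_of_le hP ?_
  set L := Real.logb 2 P with hLdef
  have hPL : P = 2 ^ L := (Real.rpow_logb two_pos (by norm_num) (by linarith)).symm
  set t := (2 : ℝ) ^ (-(b - η) * L) with ht
  set k := (2 : ℝ) ^ (η / 2 * L) with hk
  have ht0 : 0 < t := by positivity
  have ht1 : t ≤ 1 := Real.rpow_le_one_of_one_le_of_nonpos one_le_two (by nlinarith)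
  have hk1 : 1 ≤ k := Real.one_le_rpow one_le_two (by positivity)
  -- Here α < M-1 enters: b < 1 makes the exponent 1 - (b-η) positive, so noise does not dominate.
  have hPt : 1 ≤ P * t := by
    rw [hPL, ht, ← Real.rpow_add two_pos]
    exact Real.one_le_rpow one_le_two (by nlinarith)
  have hkt : k * t = 2 ^ ((η / 2 - (b - η)) * L) := by
    rw [hk, ht, ← Real.rpow_add two_pos]
    congr 1
    ring
  have hQ := hμ.measureReal_sinr_lt (B := B P) (k := k) (by linarith : 0 < P) ht0 hPt hk1
    (by rw [hkt]; linarith) (fun h hh => (hcap h hh t ht0.le ht1).1) i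
  have hlogT : Real.logb 2 (1 / (8 * M * k ^ 2 * t)) = ((b - 2 * η) - D / L) * L := by
    have h1 : k ^ 2 * t = 2 ^ (-(b - 2 * η) * L) := by
      rw [hk, ht, ← Real.rpow_natCast, ← Real.rpow_mul two_pos.le, ← Real.rpow_add two_pos]
      congr 1
      push_cast
      ring
    rw [mul_assoc _ (k ^ 2), h1, one_div, Real.logb_inv, Real.logb_mul (by positivity)
      (by positivity), Real.logb_rpow two_pos (by norm_num), sub_mul, div_mul_cancel₀ _ hL.ne']
    ring
  have hT : 1 ≤ 1 / (8 * M * k ^ 2 * t) := by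
    rw [← Real.logb_nonneg_iff one_lt_two (by positivity), hlogT]
    positivity
  have hR := le_userRate μ (B := B P) (by linarith : 0 ≤ P) hT i
  rw [hlogT] at hR
  rw [le_div_iff₀ hL, mul_assoc]
  refine le_trans ?_ hR
  rw [mul_left_comm (2 ^ B P) c] at hQ
  gcongr

/-- Every user achieves the multiplexing gain `α / (M - 1)`. -/
theorem IsIsotropic.tendsto_userRate (hμ : IsIsotropic μ) (hM : 2 ≤ M)
    (hB : Tendsto (fun P : ℝ => (B P : ℝ) / Real.logb 2 P) atTop (𝓝 α)) (hα : 0 ≤ α)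
    (hα1 : α < (M - 1 : ℕ)) (i : Fin M) :
    Tendsto (fun P => userRate μ (B P) P i / Real.logb 2 P) atTop (𝓝 (α / (M - 1 : ℕ))) := by
  refine tendsto_order.2 ⟨fun a ha => ?_, fun a ha => ?_⟩
  · filter_upwards [hμ.eventually_lt_userRate_div hM hB hα1
      (by linarith : 0 < (α / (M - 1 : ℕ) - a) / 3) i] with P hP
    linarith
  · filter_upwards [hμ.eventually_userRate_div_lt hM hB hα
      (by linarith : 0 < (a - α / (M - 1 : ℕ)) / 3) i] with P hP
    linarith

end Asymptotics

end LimitedFeedback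

/-! ### The main theorem, by summation over users. -/

theorem theorem4 (M : ℕ) (hM : 2 ≤ M) (α : ℝ) (hα : α < (M : ℝ) - 1)
    (B : ℝ → ℕ)
    (hB : Filter.Tendsto (fun P : ℝ => (B P : ℝ) / Real.logb 2 P) Filter.atTop (nhds α))
    (μ : MeasureTheory.Measure (LimitedFeedback.CVec M)) (hμ : LimitedFeedback.IsIsotropic μ) :
    (∀ P : ℝ, 0 < P → ∀ i : Fin M,
      MeasureTheory.Integrable (LimitedFeedback.instantRate P i)
        (LimitedFeedback.systemLaw μ (B P))) ∧
    LimitedFeedback.HasMultiplexingGain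
      (fun P => LimitedFeedback.throughput μ (B P) P) ((M : ℝ) * (α / ((M : ℝ) - 1))) ∧
    (M : ℝ) * (α / ((M : ℝ) - 1)) < (M : ℝ) := by
  have := hμ.isProbabilityMeasure
  have hM2 : (2 : ℝ) ≤ M := by exact_mod_cast hM
  have hcast : ((M - 1 : ℕ) : ℝ) = (M : ℝ) - 1 := by
    rw [Nat.cast_sub (by omega), Nat.cast_one]
  have hα0 : 0 ≤ α := by
    refine ge_of_tendsto hB ?_
    filter_upwards [eventually_ge_atTop 1] with P hP
    have := Real.logb_nonneg one_lt_two hP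
    positivity
  refine ⟨fun P hP i => LimitedFeedback.integrable_instantRate μ hP.le i, ?_, ?_⟩
  · have h := tendsto_finsetSum Finset.univ fun i _ =>
      hμ.tendsto_userRate hM hB hα0 (by rwa [hcast]) i
    rw [Finset.sum_const, Finset.card_univ, Fintype.card_fin, nsmul_eq_mul, hcast] at h
    refine h.congr fun P => ?_
    simp only [LimitedFeedback.throughput, Finset.sum_div]
  · have h1 : α / ((M : ℝ) - 1) < 1 := (div_lt_one (by linarith)).2 hα
    nlinarith
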